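/- **Setting.** The state space is $\Omega=\{0,1\}$; beliefs are identified with the probability $\mu\in[0,1]$ of state $1$. An adviser's signal is normalised to be the posterior $s\in[0,1]$ that it induces; $s$ has law $\tau$ with a strictly positive density on $[0,1]$, and given $s$ the state is $1$ with probability $s$ (the prior is the mean of $\tau$). The agent privately observes a type $\theta\in\Theta$, with law $f(\cdot|\omega)$ in state $\omega$, independent of $s$ given $\omega$, and takes an action $a\in A$; $A$ and $\Theta$ are compact metric spaces, and the utility $u(a,\omega,\theta)$ is bounded, measurable, and continuous in $a$. With probability $\alpha\in[0,1]$ the adviser reports $m=s$ ("aligned"); otherwise he reports $m\sim\beta(\cdot|s)$ for some kernel $\beta$ from $[0,1]$ to $[0,1]$. A strategy of the agent is a Markov kernel $\sigma:[0,1]\times\Theta\to\Delta(A)$; $\hat\sigma(m)=\sigma(m,\cdot):\Theta\to\Delta(A)$ is the private strategy it prescribes after the message $m$. The strategy $\sigma$ is *optimal* if it maximises $$U(\sigma)=\alpha\,\mathbb E_{\mathrm{id},\sigma}[u(a,\omega,\theta)]+(1-\alpha)\inf_{\beta}\mathbb E_{\beta,\sigma}[u(a,\omega,\theta)]$$ over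 all strategies, and $\beta$ is *adversarial* against $\sigma$ if it attains the value $U(\sigma)$ in this expression. Two strategies are *equivalent* if, together with some adversarial strategies against them, they induce the same joint distribution of states, types, messages and actions. For a private strategy $\hat\rho$ let $U(\hat\rho,\mu)$ be its expected utility when the state has law $\mu$; $\hat\rho$ is *Bayes-optimal* for $\mu$ if it maximises $U(\cdot,\mu)$, and $U(\mu)=\sup_{\hat\rho}U(\hat\rho,\mu)$. A strategy is a *trust region strategy* with compact trust region $T\subseteq[0,1]$ if $\hat\sigma(m)$ is Bayes-optimal for $m$ for every $m\in T$, and for every $m\notin T$ it is Bayes-optimal for some $P(m)\in\arg\max_{m'\in T}U(\hat\sigma(m'),m)$. **Statement.** Suppose that $\mu\mapsto U(\mu)$ is strictly convex on $[0,1]$ and twice differentiable on $(0,1)$. Then for every optimal strategy $\sigma^*$ there is an interval $[\underline\mu,\overline\mu]\subseteq[0,1]$, $\underline\mu\le\overline\mu$, such that: 1. For $\tau$-almost every message $m$, $\hat\sigma^*(m)$ is Bayes-optimal for $m$ if $m\in[\underline\mu,\overline\mu]$, for $\underline\mu$ if $m<\underline\mu$, and for $\overline\mu$ if $m>\overline\mu$.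 2. Consequently $\hat\sigma^*(m)=\hat\sigma_0(m)$, $\hat\sigma_0(\underline\mu)$, $\hat\sigma_0(\overline\mu)$ respectively, for $\tau$-almost every $m$, where $\hat\sigma_0(\mu)$ denotes the Bayes-optimal private strategy for $\mu$. In general this equality means equality of the expected utilities in each state, whatever choice of Bayes-optimal private strategies $\hat\sigma_0(\mu)$, $\mu\in(0,1)$, is made; if the Bayes-optimal private strategy for each $\mu\in(0,1)$ is unique up to $f(\cdot|\omega)$-null sets of types for both $\omega$, it means equality for $f(\cdot|\omega)$-almost all types, for both $\omega$. 3. $\sigma^*$ is equivalent to a trust region strategy with trust region $[\underline\mu,\overline\mu]$ that follows the rule in 1 after every message $m\in[0,1]$. -/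

import Mathlib

open MeasureTheory ProbabilityTheory Set
open scoped ENNReal

namespace TrustRegion

/-- Primitives of the advice game with binary state `Ω = {0, 1}` (here `Fin 2`).
Beliefs, adviser signals and messages are points of `[0, 1]`: the probability of state `1`.
The adviser's signal is normalised to be the posterior that it induces, so its unconditional law,
given by a strictly positive density on `[0, 1]`, determines the joint law of signal and state
(and the prior, which is the mean of that law). -/
structure Model (A Θ : Type*) [MetricSpace A] [MeasurableSpace A]
    [MetricSpace Θ] [MeasurableSpace Θ] where
  /-- conditional law of the agent's private type given the state -/
  f : Fin 2 → Measure Θ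
  f_prob : ∀ ω, IsProbabilityMeasure (f ω)
  /-- ex-post utility of the agent -/
  u : A → Fin 2 → Θ → ℝ
  u_measurable : ∀ ω, Measurable fun p : A × Θ => u p.1 ω p.2
  u_continuous : ∀ ω θ, Continuous fun a => u a ω θ
  u_bounded : ∃ C : ℝ, ∀ a ω θ, |u a ω θ| ≤ C
  /-- density of the adviser's posterior with respect to Lebesgue measure on `[0, 1]` -/
  density : unitInterval → ℝ
  density_measurable : Measurable density
  density_pos : ∀ s, 0 < density s
  density_integral : ∫⁻ s, ENNReal.ofReal (density s) = 1
  /-- probability that the adviser is aligned -/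
  α : ℝ
  α_nonneg : 0 ≤ α
  α_le_one : α ≤ 1

/-- The agent's strategies `σ : Δ(Ω) × Θ → Δ(A)`. -/
abbrev Strategy (A Θ : Type*) [MeasurableSpace A] [MeasurableSpace Θ] :=
  {σ : Kernel (unitInterval × Θ) A // IsMarkovKernel σ}

/-- Private strategies `Θ → Δ(A)`. -/
abbrev PrivateStrategy (A Θ : Type*) [MeasurableSpace A] [MeasurableSpace Θ] :=
  {ρ : Kernel Θ A // IsMarkovKernel ρ}

/-- Reporting strategies of the adviser: a law of messages for every posterior. -/
abbrev Reporting := {β : Kernel unitInterval unitInterval // IsMarkovKernel β}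

/-- Truthful reporting, the behaviour of the aligned adviser. -/
noncomputable def truthful : Reporting := ⟨Kernel.id, inferInstance⟩

/-- The probability of state `ω` under the belief `μ`. -/
def prob (μ : ℝ) (ω : Fin 2) : ℝ := if ω = 1 then μ else 1 - μ

section

variable {A Θ : Type*} [MeasurableSpace A] [MeasurableSpace Θ]

/-- The private strategy that `σ` prescribes after the message `m`. -/
noncomputable def Strategy.afterMessage (σ : Strategy A Θ) (m : unitInterval) :
    PrivateStrategy A Θ :=
  ⟨σ.1.comap (fun θ => (m, θ)) measurable_prodMk_left,
    haveI := σ.2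
    inferInstance⟩

end

namespace Model

variable {A Θ : Type*} [MetricSpace A] [MeasurableSpace A] [MetricSpace Θ] [MeasurableSpace Θ]
  (M : Model A Θ)

/-- The unconditional law of the adviser's posterior. -/
noncomputable def τ : Measure unitInterval :=
  volume.withDensity fun s => ENNReal.ofReal (M.density s)

/-- Joint law of state, message, type and action when the adviser reports according to `β` and
the agent plays `σ`: the posterior `s` has law `τ`, the state is `ω` with probability `prob s ω`,
the message has law `β s`, the type has law `f ω` independently of `s` and the message given the
state, and the action has law `σ (m, θ)`. -/
noncomputable def outcomeLaw (β : Reporting) (σ : Strategy A Θ) :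
    Measure (Fin 2 × ((unitInterval × Θ) × A)) :=
  ∑ ω : Fin 2, (Measure.dirac ω).prod
    ((((M.τ.withDensity fun s => ENNReal.ofReal (prob s ω)).bind β.1).prod (M.f ω)) ⊗ₘ σ.1)

/-- Expected utility of the agent when the adviser reports according to `β`. -/
noncomputable def expectedUtility (β : Reporting) (σ : Strategy A Θ) : ℝ :=
  ∫ x, M.u x.2.2 x.1 x.2.1.2 ∂M.outcomeLaw β σ

/-- Worst-case payoff of the strategy `σ`. -/
noncomputable def worstCase (σ : Strategy A Θ) : ℝ :=
  M.α * M.expectedUtility truthful σ + (1 - M.α) * ⨅ β : Reporting, M.expectedUtility β σ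

/-- `σ` maximises the worst-case payoff over all strategies. -/
def IsOptimal (σ : Strategy A Θ) : Prop := ∀ σ' : Strategy A Θ, M.worstCase σ' ≤ M.worstCase σ

/-- `β` attains the infimum in the worst-case payoff of `σ`. -/
def IsAdversarial (β : Reporting) (σ : Strategy A Θ) : Prop :=
  M.α * M.expectedUtility truthful σ + (1 - M.α) * M.expectedUtility β σ = M.worstCase σ

/-- Joint law of state, message, type and action when the adviser is truthful with probability `α`
and reports according to `β` with probability `1 - α`. -/
noncomputable def totalLaw (β : Reporting) (σ : Strategy A Θ) :
    Measure (Fin 2 × ((unitInterval × Θ) × A)) :=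
  ENNReal.ofReal M.α • M.outcomeLaw truthful σ + ENNReal.ofReal (1 - M.α) • M.outcomeLaw β σ

/-- Two strategies are equivalent if, together with some adversarial strategies against them, they
induce the same joint law of states, types, messages and actions. -/
def Equivalent (σ σ' : Strategy A Θ) : Prop :=
  ∃ β β' : Reporting, M.IsAdversarial β σ ∧ M.IsAdversarial β' σ' ∧
    M.totalLaw β σ = M.totalLaw β' σ'

/-- Expected utility of the private strategy `ρ` conditional on the state. -/
noncomputable def stateUtility (ρ : PrivateStrategy A Θ) (ω : Fin 2) : ℝ :=
  ∫ θ, ∫ a, M.u a ω θ ∂ρ.1 θ ∂M.f ω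

/-- Expected utility `U(ρ, μ)` of the private strategy `ρ` under the belief `μ`. -/
noncomputable def privateUtility (ρ : PrivateStrategy A Θ) (μ : ℝ) : ℝ :=
  ∑ ω : Fin 2, prob μ ω * M.stateUtility ρ ω

/-- `ρ` maximises the expected utility under the belief `μ`. -/
def IsBayesOptimal (ρ : PrivateStrategy A Θ) (μ : ℝ) : Prop :=
  ∀ ρ' : PrivateStrategy A Θ, M.privateUtility ρ' μ ≤ M.privateUtility ρ μ

/-- The indirect utility `U(μ)`. -/
noncomputable def indirectUtility (μ : ℝ) : ℝ :=
  ⨆ ρ : PrivateStrategy A Θ, M.privateUtility ρ μ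

/-- `σ` is a trust region strategy with trust region `T`. -/
def IsTrustRegionStrategy (σ : Strategy A Θ) (T : Set unitInterval) : Prop :=
  IsCompact T ∧
  (∀ m ∈ T, M.IsBayesOptimal (σ.afterMessage m) m) ∧
  ∀ m ∉ T, ∃ p ∈ T,
    (∀ m' ∈ T, M.privateUtility (σ.afterMessage m') m ≤ M.privateUtility (σ.afterMessage p) m) ∧
    M.IsBayesOptimal (σ.afterMessage m) p

end Model

/-- The relation `R` holds between the private strategy played after the message `m` and the belief
at which the trust interval `[lo, hi]` makes the agent act: `m` itself inside the interval, `lo`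
below it and `hi` above it. -/
def TrustIntervalRule {A Θ : Type*} [MeasurableSpace A] [MeasurableSpace Θ]
    (R : PrivateStrategy A Θ → unitInterval → Prop) (σ : Strategy A Θ)
    (lo hi m : unitInterval) : Prop :=
  (m ∈ Icc lo hi → R (σ.afterMessage m) m) ∧
  (m < lo → R (σ.afterMessage m) lo) ∧
  (hi < m → R (σ.afterMessage m) hi)

end TrustRegion

/-! The payoff of a private strategy is affine in the belief and lies below the convex indirect
utility `U`, so a strategy is a family of lines below `U`, one per message. By the envelope theorem,
a Bayes-optimal reply at an interior belief pays the tangent of `U` there. A truthful adviser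
selects the line of his own signal; an adversary can press the payoff down to the lower envelope `g`
of the family.

Let `a` and `b` be the least and the greatest belief whose supporting line lies above `g`. Every
line of the family can be raised to a supporting line (`exists_supportLine_ge`), which is then above
`g` as well. Hence at each signal the supporting line at the nearest point of `[a, b]` is at least
as good as any line of the family, and the minimum of the two extreme lines is still above `g`
(`exists_interval`). The trust interval thus does at least as well against both kinds of adviser.
For an optimal strategy and `0 < α < 1` equality must hold, and this forces almost every line to
touch `U` at that nearest point.

The difficulty is at beliefs `0` and `1`, where a Bayes-optimal reply need not pay the line with the
limiting slope, so such intervals need not be attainable. They are excluded by a first-order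
argument (`exists_intervalValue_lt_left`): cutting off beliefs below `ε` changes the slope by `δ`,
costs at most `δ * ε` under truth, and gains a fixed multiple of `δ` against the adversary. The
cases `α = 0` and `α = 1` are direct. Equivalence follows by correcting the strategy on a null set
of messages that an adversary can avoid, since `τ` has full support. -/

namespace TrustRegion

/-! ### Measurable selection and bounded integrals -/

/-- A Carathéodory function on a compact metric space has a measurable selection of maximisers. -/
theorem exists_measurable_argmax {X A : Type*} [MeasurableSpace X] [MetricSpace A] [CompactSpace A]
    [Nonempty A] [MeasurableSpace A] [BorelSpace A] (v : X → A → ℝ)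
    (hm : ∀ a, Measurable fun x => v x a) (hc : ∀ x, Continuous (v x)) :
    ∃ s : X → A, Measurable s ∧ ∀ x a, v x a ≤ v x (s x) := by
  -- The Cantor set maps onto `A`, and its order as a set of reals singles out one maximiser, the
  -- least.
  obtain ⟨φ, hφ, hφs⟩ := exists_nat_bool_continuous_surjective_of_compact A
  set ψ : cantorSet → A := φ ∘ cantorSetHomeomorphNatToBool with hψ
  have hψc : Continuous ψ := hφ.comp cantorSetHomeomorphNatToBool.continuous
  have hψs : Function.Surjective ψ := hφs.comp cantorSetHomeomorphNatToBool.surjective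
  have : CompactSpace cantorSet := isCompact_iff_compactSpace.1 isCompact_cantorSet
  have : Nonempty cantorSet := ⟨cantorSetHomeomorphNatToBool.symm fun _ => true⟩
  have hvc : ∀ x, Continuous fun c => v x (ψ c) := fun x => (hc x).comp hψc
  let K : X → Set cantorSet := fun x => {c | ∀ d, v x (ψ d) ≤ v x (ψ c)}
  have hK : ∀ x, (K x).Nonempty ∧ IsCompact (K x) := fun x => by
    refine ⟨?_, ?_⟩
    · obtain ⟨c, -, hcmax⟩ := isCompact_univ.exists_isMaxOn univ_nonempty (hvc x).continuousOn
      exact ⟨c, fun d => hcmax (mem_univ d)⟩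
    · refine IsClosed.isCompact ?_
      simp only [K, Set.ofPred_forall]
      exact isClosed_iInter fun d => isClosed_le continuous_const (hvc x)
  have hleast : ∀ x, ∃ c ∈ K x, ∀ d ∈ K x, (c : ℝ) ≤ d := fun x =>
    (hK x).2.exists_isMinOn (hK x).1 continuous_subtype_val.continuousOn
  choose t htK htmin using hleast
  refine ⟨fun x => ψ (t x), hψc.measurable.comp ?_, fun x a => ?_⟩
  · refine (MeasurableEmbedding.subtype_coe isClosed_cantorSet.measurableSet).measurable_comp_iff.1
      (measurable_of_Iic fun r => ?_)
    obtain ⟨D, hDc, hD⟩ := TopologicalSpace.exists_countable_dense cantorSet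
    obtain ⟨E, hEc, hE⟩ := TopologicalSpace.exists_countable_dense {c : cantorSet // (c : ℝ) ≤ r}
    -- The least maximiser is at most `r` iff points up to `r` do as well as all points. By
    -- continuity and compactness it is enough to test countable dense sets with margins `1 / (n +
    -- 1)`.
    have hset : (Subtype.val ∘ t) ⁻¹' Iic r =
        ⋂ d ∈ D, ⋂ n : ℕ, ⋃ c ∈ E, {x | v x (ψ d) < v x (ψ c.1) + 1 / ((n : ℝ) + 1)} := by
      ext x
      simp only [mem_preimage, Function.comp_apply, mem_Iic, mem_iInter, mem_iUnion, exists_prop]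
      refine ⟨fun hx d _ n => ?_, fun hx => ?_⟩
      · have hlt : v x (ψ d) < v x (ψ (t x)) + 1 / ((n : ℝ) + 1) :=
          (htK x d).trans_lt (lt_add_of_pos_right _ (by positivity))
        obtain ⟨c, hcE, hc'⟩ := hE.exists_mem_open
          (isOpen_lt continuous_const (((hvc x).comp continuous_subtype_val).add continuous_const))
          ⟨⟨t x, hx⟩, hlt⟩
        exact ⟨c, hcE, hc'⟩
      · have hS : IsCompact {c : cantorSet | (c : ℝ) ≤ r} :=
          (isClosed_le continuous_subtype_val continuous_const).isCompact
        have hSne : {c : cantorSet | (c : ℝ) ≤ r}.Nonempty := by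
          obtain ⟨d, hd⟩ := hD.nonempty
          obtain ⟨c, -, -⟩ := hx d hd 0
          exact ⟨c.1, c.2⟩
        obtain ⟨c, hcr, hcmax⟩ := hS.exists_isMaxOn hSne (hvc x).continuousOn
        refine (htmin x c fun d => ?_).trans hcr
        refine hD.induction (P := fun d => v x (ψ d) ≤ v x (ψ c)) (fun d hd => ?_)
          (isClosed_le (hvc x) continuous_const) d
        refine le_of_forall_pos_le_add fun ε hε => ?_
        obtain ⟨n, hn⟩ := exists_nat_one_div_lt hε
        obtain ⟨e, -, he⟩ := hx d hd n
        have := hcmax e.2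
        simp only [mem_ofPred_eq] at he this
        linarith
    rw [hset]
    refine MeasurableSet.biInter hDc fun d _ => MeasurableSet.iInter fun n =>
      MeasurableSet.biUnion hEc fun c _ => measurableSet_lt (hm _) ((hm _).add_const _)
  · obtain ⟨d, rfl⟩ := hψs a
    exact htK x d

theorem norm_integral_le_of_forall_norm_le {X : Type*} [MeasurableSpace X] (μ : Measure X)
    [IsProbabilityMeasure μ] {h : X → ℝ} {C : ℝ} (hC : ∀ x, |h x| ≤ C) : |∫ x, h x ∂μ| ≤ C := by
  simpa using norm_integral_le_of_norm_le_const (μ := μ) (f := h) (.of_forall hC)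

theorem integrable_of_forall_abs_le {X : Type*} [MeasurableSpace X] {μ : Measure X}
    [IsFiniteMeasure μ] {h : X → ℝ} (hm : Measurable h) {C : ℝ} (hC : ∀ x, |h x| ≤ C) :
    Integrable h μ :=
  Integrable.of_bound hm.aestronglyMeasurable C (.of_forall hC)

theorem prob_nonneg (s : unitInterval) (ω : Fin 2) : 0 ≤ prob s ω := by
  unfold prob
  split_ifs
  exacts [s.2.1, sub_nonneg.2 s.2.2]

theorem prob_le_one (s : unitInterval) (ω : Fin 2) : prob s ω ≤ 1 := by
  unfold prob
  split_ifs
  exacts [s.2.2, sub_le_self _ s.2.1]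

theorem continuous_prob (ω : Fin 2) : Continuous fun s : ℝ => prob s ω := by
  unfold prob
  split_ifs <;> fun_prop

theorem measurable_prob_coe (ω : Fin 2) : Measurable fun s : unitInterval => prob s ω :=
  ((continuous_prob ω).comp continuous_subtype_val).measurable

/-! ### Payoffs as integrals of affine functions of the signal -/

namespace Model

variable {A Θ : Type*} [MetricSpace A] [MeasurableSpace A]
  [MetricSpace Θ] [MeasurableSpace Θ] (M : Model A Θ)

instance isProbabilityMeasure_f (ω : Fin 2) : IsProbabilityMeasure (M.f ω) := M.f_prob ω

instance isProbabilityMeasure_τ : IsProbabilityMeasure M.τ :=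
  ⟨by rw [τ, withDensity_apply _ MeasurableSet.univ, Measure.restrict_univ, M.density_integral]⟩

instance nullSingletonClass_τ : NullSingletonClass M.τ := by
  unfold τ; infer_instance

instance isFiniteMeasure_τ_withDensity (ω : Fin 2) :
    IsFiniteMeasure (M.τ.withDensity fun s => ENNReal.ofReal (prob s ω)) := by
  refine isFiniteMeasure_withDensity_ofReal (Integrable.hasFiniteIntegral (μ := M.τ) ?_)
  exact integrable_of_forall_abs_le (measurable_prob_coe ω)
    fun s => (abs_of_nonneg (prob_nonneg s ω)).le.trans (prob_le_one s ω)

theorem privateUtility_eq (ρ : PrivateStrategy A Θ) (x : ℝ) :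
    M.privateUtility ρ x = (1 - x) * M.stateUtility ρ 0 + x * M.stateUtility ρ 1 := by
  simp [privateUtility, Fin.sum_univ_two, prob]

theorem measurable_actionUtility (ρ : PrivateStrategy A Θ) (ω : Fin 2) :
    Measurable fun θ => ∫ a, M.u a ω θ ∂ρ.1 θ := by
  have := ρ.2
  exact (StronglyMeasurable.integral_kernel_prod_right (κ := ρ.1) (f := fun θ a => M.u a ω θ)
    ((M.u_measurable ω).comp measurable_swap).stronglyMeasurable).measurable

theorem measurable_actionUtility_message (σ : Strategy A Θ) (ω : Fin 2) :
    Measurable fun p : unitInterval × Θ => ∫ a, M.u a ω p.2 ∂σ.1 p := by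
  have := σ.2
  exact (StronglyMeasurable.integral_kernel_prod_right (κ := σ.1)
    (f := fun (p : unitInterval × Θ) a => M.u a ω p.2)
    ((M.u_measurable ω).comp
      (measurable_snd.prodMk (measurable_snd.comp measurable_fst))).stronglyMeasurable).measurable

theorem measurable_stateUtility_afterMessage (σ : Strategy A Θ) (ω : Fin 2) :
    Measurable fun m => M.stateUtility (σ.afterMessage m) ω :=
  (StronglyMeasurable.integral_prod_right' (ν := M.f ω)
    (M.measurable_actionUtility_message σ ω).stronglyMeasurable).measurable

theorem exists_stateUtility_bound :
    ∃ C : ℝ, 0 ≤ C ∧ ∀ (ρ : PrivateStrategy A Θ) ω, |M.stateUtility ρ ω| ≤ C := by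
  obtain ⟨C, hC⟩ := M.u_bounded
  refine ⟨|C|, abs_nonneg C, fun ρ ω => norm_integral_le_of_forall_norm_le _ fun θ => ?_⟩
  have := ρ.2
  exact norm_integral_le_of_forall_norm_le _ fun a => (hC a ω θ).trans (le_abs_self C)

/-- Fubini: given signal and state, the type is independent of the message. This reduces the game to
the lines `M.privateUtility (σ.afterMessage m)`. -/
theorem expectedUtility_eq (β : Reporting) (σ : Strategy A Θ) :
    M.expectedUtility β σ =
      ∫ s, ∫ m, M.privateUtility (σ.afterMessage m) s ∂β.1 s ∂M.τ := by
  have hσ := σ.2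
  have hβ := β.2
  obtain ⟨C, hC⟩ := M.u_bounded
  obtain ⟨D, hD0, hD⟩ := M.exists_stateUtility_bound
  have hu : ∀ ω : Fin 2, Measurable fun x : (unitInterval × Θ) × A => M.u x.2 ω x.1.2 := fun ω =>
    (M.u_measurable ω).comp (measurable_snd.prodMk (measurable_snd.comp measurable_fst))
  have hu' : Measurable fun x : Fin 2 × ((unitInterval × Θ) × A) => M.u x.2.2 x.1 x.2.1.2 :=
    measurable_from_prod_countable_right hu
  have hst : ∀ ω s, Integrable (fun m => M.stateUtility (σ.afterMessage m) ω) (β.1 s) :=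
    fun ω s => integrable_of_forall_abs_le (M.measurable_stateUtility_afterMessage σ ω)
      fun m => hD _ _
  have hst' : ∀ ω, Measurable fun s => ∫ m, M.stateUtility (σ.afterMessage m) ω ∂β.1 s := fun ω =>
    (StronglyMeasurable.integral_kernel_prod_right (κ := β.1)
      (f := fun _ m => M.stateUtility (σ.afterMessage m) ω)
      ((M.measurable_stateUtility_afterMessage σ ω).comp measurable_snd).stronglyMeasurable).measurable
  unfold expectedUtility outcomeLaw
  rw [integral_finsetSum_measure fun ω _ => integrable_of_forall_abs_le hu' fun x => hC _ _ _]
  have key : ∀ ω : Fin 2, ∫ x, M.u x.2.2 x.1 x.2.1.2 ∂((Measure.dirac ω).prod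
      ((((M.τ.withDensity fun s => ENNReal.ofReal (prob s ω)).bind β.1).prod (M.f ω)) ⊗ₘ σ.1)) =
      ∫ s, prob s ω * ∫ m, M.stateUtility (σ.afterMessage m) ω ∂β.1 s ∂M.τ := fun ω => by
    rw [Measure.dirac_prod, integral_map measurable_prodMk_left.aemeasurable
      hu'.aestronglyMeasurable, Measure.integral_compProd
      (integrable_of_forall_abs_le (hu ω) fun x => hC _ _ _), integral_prod _
      (integrable_of_forall_abs_le (M.measurable_actionUtility_message σ ω) (C := C)
        fun p => norm_integral_le_of_forall_norm_le _ fun a => hC _ _ _), ← Measure.snd_compProd,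
      Measure.snd]
    refine (integral_map measurable_snd.aemeasurable
      (M.measurable_stateUtility_afterMessage σ ω).aestronglyMeasurable).trans ?_
    have hi := integrable_of_forall_abs_le
      (μ := (M.τ.withDensity fun s => ENNReal.ofReal (prob s ω)) ⊗ₘ β.1)
      ((M.measurable_stateUtility_afterMessage σ ω).comp measurable_snd) (C := D)
      fun p => hD _ _
    refine (Measure.integral_compProd hi).trans ?_
    rw [integral_withDensity_eq_integral_toReal_smul (measurable_prob_coe ω).ennreal_ofReal
      (.of_forall fun _ => ENNReal.ofReal_lt_top)]
    refine integral_congr_ae (.of_forall fun s => ?_)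
    simp [ENNReal.toReal_ofReal (prob_nonneg s ω)]
  rw [Finset.sum_congr rfl fun ω _ => key ω, ← integral_finsetSum]
  · refine integral_congr_ae (.of_forall fun s => ?_)
    simp only [privateUtility]
    rw [integral_finsetSum _ fun ω _ => (hst ω s).const_mul _]
    simp only [integral_const_mul]
  · intro ω _
    refine integrable_of_forall_abs_le ((measurable_prob_coe ω).mul (hst' ω)) (C := D) fun s => ?_
    rw [abs_mul, abs_of_nonneg (prob_nonneg s ω)]
    exact (mul_le_of_le_one_left (abs_nonneg _) (prob_le_one s ω)).trans
      (norm_integral_le_of_forall_norm_le _ fun m => hD _ _)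

/-- Expected utility when the adviser's message is a function of his signal. -/
theorem expectedUtility_deterministic (σ : Strategy A Θ) {r : unitInterval → unitInterval}
    (hr : Measurable r) :
    M.expectedUtility ⟨Kernel.deterministic r hr, inferInstance⟩ σ =
      ∫ s, M.privateUtility (σ.afterMessage (r s)) s ∂M.τ := by
  rw [expectedUtility_eq]
  refine integral_congr_ae (.of_forall fun s => ?_)
  simp only [Kernel.deterministic_apply]
  refine integral_dirac' _ _ (Measurable.stronglyMeasurable ?_)
  simp only [privateUtility_eq]
  exact ((M.measurable_stateUtility_afterMessage σ 0).const_mul _).add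
    ((M.measurable_stateUtility_afterMessage σ 1).const_mul _)

theorem expectedUtility_truthful (σ : Strategy A Θ) :
    M.expectedUtility truthful σ = ∫ s, M.privateUtility (σ.afterMessage s) s ∂M.τ :=
  M.expectedUtility_deterministic σ measurable_id

end Model
-- Bayes-optimal replies and the adversary's infimum
namespace Model

variable {A Θ : Type*} [MetricSpace A] [MeasurableSpace A]
  [MetricSpace Θ] [MeasurableSpace Θ] (M : Model A Θ)

theorem exists_privateUtility_bound : ∃ C : ℝ, 0 ≤ C ∧
    ∀ (ρ : PrivateStrategy A Θ) (x : unitInterval), |M.privateUtility ρ x| ≤ C := by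
  obtain ⟨C, hC0, hC⟩ := M.exists_stateUtility_bound
  refine ⟨C, hC0, fun ρ x => ?_⟩
  rw [privateUtility_eq]
  have h0 := abs_le.1 (hC ρ 0)
  have h1 := abs_le.1 (hC ρ 1)
  have hx0 := x.2.1
  have hx1 := x.2.2
  exact abs_le.2 ⟨by nlinarith, by nlinarith⟩

theorem bddAbove_privateUtility (x : unitInterval) :
    BddAbove (range fun ρ : PrivateStrategy A Θ => M.privateUtility ρ x) := by
  obtain ⟨C, -, hC⟩ := M.exists_privateUtility_bound
  exact ⟨C, forall_mem_range.2 fun ρ => (le_abs_self _).trans (hC ρ x)⟩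

theorem privateUtility_le_indirectUtility (ρ : PrivateStrategy A Θ) (x : unitInterval) :
    M.privateUtility ρ x ≤ M.indirectUtility x :=
  le_ciSup (M.bddAbove_privateUtility x) ρ

theorem isBayesOptimal_iff (ρ : PrivateStrategy A Θ) (x : unitInterval) :
    M.IsBayesOptimal ρ x ↔ M.privateUtility ρ x = M.indirectUtility x :=
  ⟨fun h => (M.privateUtility_le_indirectUtility ρ x).antisymm
      (haveI : Nonempty (PrivateStrategy A Θ) := ⟨ρ⟩; ciSup_le h),
    fun h ρ' => (M.privateUtility_le_indirectUtility ρ' x).trans h.ge⟩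

theorem measurable_privateUtility_afterMessage (σ : Strategy A Θ) {r x : unitInterval → unitInterval}
    (hr : Measurable r) (hx : Measurable x) :
    Measurable fun s => M.privateUtility (σ.afterMessage (r s)) (x s) := by
  simp only [privateUtility_eq]
  have := M.measurable_stateUtility_afterMessage σ
  exact ((hx.subtype_val.const_sub 1).mul ((this 0).comp hr)).add
    (hx.subtype_val.mul ((this 1).comp hr))

theorem integrable_privateUtility_afterMessage (σ : Strategy A Θ)
    {r : unitInterval → unitInterval} (hr : Measurable r) :
    Integrable (fun s : unitInterval => M.privateUtility (σ.afterMessage (r s)) s) M.τ := by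
  obtain ⟨C, -, hC⟩ := M.exists_privateUtility_bound
  exact integrable_of_forall_abs_le
    (M.measurable_privateUtility_afterMessage σ hr measurable_id) fun s => hC _ s

/-- There is a strategy that answers every message by a Bayes-optimal private strategy. -/
theorem exists_bayesOptimal_strategy [CompactSpace A] [BorelSpace A] [Nonempty A] :
    ∃ σ : Strategy A Θ, ∀ m : unitInterval, M.IsBayesOptimal (σ.afterMessage m) m := by
  obtain ⟨C, hC⟩ := M.u_bounded
  -- The sum dominates both type laws. With densities, the payoff is one integral over types, whose
  -- integrand can be maximised separately at each message and type.
  let lam : Measure Θ := ∑ ω, M.f ω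
  have hac : ∀ ω, M.f ω ≪ lam := fun ω =>
    Measure.absolutelyContinuous_of_le (Finset.single_le_sum (f := M.f)
      (fun _ _ => Measure.zero_le _) (Finset.mem_univ ω))
  let g : Fin 2 → Θ → ℝ := fun ω θ => ((M.f ω).rnDeriv lam θ).toReal
  have hg : ∀ ω, Measurable (g ω) := fun ω => (Measure.measurable_rnDeriv _ _).ennreal_toReal
  let v : unitInterval × Θ → A → ℝ := fun p a =>
    ∑ ω, prob p.1 ω * (g ω p.2 * M.u a ω p.2)
  obtain ⟨t, ht, hmax⟩ := exists_measurable_argmax v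
    (fun a => Finset.measurable_sum _ fun ω _ =>
      ((measurable_prob_coe ω).comp measurable_fst).mul (((hg ω).comp measurable_snd).mul
        ((M.u_measurable ω).comp (measurable_const.prodMk measurable_snd))))
    (fun p => continuous_finsetSum _ fun ω _ =>
      ((M.u_continuous ω p.2).const_mul _).const_mul _)
  have hrep : ∀ (ρ : PrivateStrategy A Θ) (x : unitInterval),
      Integrable (fun θ => ∫ a, v (x, θ) a ∂ρ.1 θ) lam ∧
      M.privateUtility ρ x = ∫ θ, ∫ a, v (x, θ) a ∂ρ.1 θ ∂lam := fun ρ x => by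
    have hρ := ρ.2
    have hv : ∀ θ, ∫ a, v (x, θ) a ∂ρ.1 θ =
        ∑ ω, prob x ω * (g ω θ * ∫ a, M.u a ω θ ∂ρ.1 θ) := fun θ => by
      rw [integral_finsetSum]
      · simp only [integral_const_mul]
      · intro ω _
        exact ((integrable_of_forall_abs_le ((M.u_measurable ω).comp
          (measurable_id.prodMk measurable_const)) fun a => hC a ω θ).const_mul _).const_mul _
    have hi : ∀ ω, Integrable (fun θ => g ω θ * ∫ a, M.u a ω θ ∂ρ.1 θ) lam := fun ω =>
      (integrable_rnDeriv_smul_iff (hac ω)).2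
        (integrable_of_forall_abs_le (M.measurable_actionUtility ρ ω)
          fun θ => norm_integral_le_of_forall_norm_le _ fun a => hC a ω θ)
    simp only [hv]
    refine ⟨integrable_finsetSum _ fun ω _ => (hi ω).const_mul _, ?_⟩
    rw [integral_finsetSum _ fun ω _ => (hi ω).const_mul _]
    refine Finset.sum_congr rfl fun ω _ => ?_
    rw [integral_const_mul, stateUtility, ← integral_rnDeriv_smul (hac ω)]
    rfl
  refine ⟨⟨Kernel.deterministic t ht, inferInstance⟩, fun m ρ => ?_⟩
  rw [(hrep ρ m).2, (hrep _ m).2]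
  refine integral_mono (hrep ρ m).1 (hrep _ m).1 fun θ => ?_
  have hρ := ρ.2
  have hvm : Measurable (v (m, θ)) := Finset.measurable_sum _ fun ω _ =>
    (((M.u_measurable ω).comp (measurable_id.prodMk measurable_const)).const_mul _).const_mul _
  have hr : ∫ a, v (m, θ) a ∂(Kernel.deterministic t ht) (m, θ) = v (m, θ) (t (m, θ)) := by
    rw [Kernel.deterministic_apply]
    exact integral_dirac' _ _ hvm.stronglyMeasurable
  refine le_trans ?_ hr.ge
  by_cases hi : Integrable (v (m, θ)) (ρ.1 θ)
  · simpa using integral_mono hi (integrable_const _) fun a => hmax (m, θ) a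
  · refine absurd (integrable_finsetSum _ fun ω _ => ?_) hi
    exact ((integrable_of_forall_abs_le ((M.u_measurable ω).comp
          (measurable_id.prodMk measurable_const)) fun a => hC a ω θ).const_mul _).const_mul _

theorem bddBelow_expectedUtility (σ : Strategy A Θ) :
    BddBelow (range fun β : Reporting => M.expectedUtility β σ) := by
  obtain ⟨C, -, hC⟩ := M.exists_privateUtility_bound
  refine ⟨-C, forall_mem_range.2 fun β => ?_⟩
  have := β.2
  rw [expectedUtility_eq]
  exact (abs_le.1 (norm_integral_le_of_forall_norm_le _ fun s =>
    norm_integral_le_of_forall_norm_le _ fun m => hC _ s)).1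

theorem integral_le_expectedUtility (σ : Strategy A Θ) (β : Reporting) {h : unitInterval → ℝ}
    (hi : Integrable h M.τ) (hh : ∀ s m : unitInterval, h s ≤ M.privateUtility (σ.afterMessage m) s) :
    ∫ s, h s ∂M.τ ≤ M.expectedUtility β σ := by
  obtain ⟨C, -, hC⟩ := M.exists_privateUtility_bound
  have := β.2
  rw [expectedUtility_eq]
  refine integral_mono hi (integrable_of_forall_abs_le (StronglyMeasurable.measurable
    (StronglyMeasurable.integral_kernel_prod_right (κ := β.1)
    (f := fun s m : unitInterval => M.privateUtility (σ.afterMessage m) s) ?_)) (C := C) fun s =>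
      norm_integral_le_of_forall_norm_le _ fun m => hC _ s) fun s => ?_
  · simp only [privateUtility_eq]
    have := M.measurable_stateUtility_afterMessage σ
    exact Measurable.stronglyMeasurable
      (((measurable_fst.subtype_val.const_sub 1).mul ((this 0).comp measurable_snd)).add
      (measurable_fst.subtype_val.mul ((this 1).comp measurable_snd)))
  · have := integral_mono (μ := β.1 s) (integrable_const (h s)) (integrable_of_forall_abs_le
      (M.measurable_privateUtility_afterMessage σ measurable_id measurable_const) fun m => hC _ s)
      (hh s)
    simpa using this

theorem integral_le_iInf_expectedUtility (σ : Strategy A Θ) {h : unitInterval → ℝ}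
    (hi : Integrable h M.τ) (hh : ∀ s m : unitInterval, h s ≤ M.privateUtility (σ.afterMessage m) s) :
    ∫ s, h s ∂M.τ ≤ ⨅ β : Reporting, M.expectedUtility β σ :=
  haveI : Nonempty Reporting := ⟨truthful⟩
  le_ciInf fun β => M.integral_le_expectedUtility σ β hi hh

/-- The adviser can hold the agent down to `h` if for each signal some messages do. -/
theorem iInf_expectedUtility_le_integral (σ : Strategy A Θ) {h : unitInterval → ℝ}
    (hcont : Continuous h) (hi : Integrable h M.τ)
    (hh : ∀ (s : unitInterval) (ε : ℝ), 0 < ε →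
      ∃ m, M.privateUtility (σ.afterMessage m) s < h s + ε) :
    ⨅ β : Reporting, M.expectedUtility β σ ≤ ∫ s, h s ∂M.τ := by
  classical
  refine le_of_forall_pos_le_add fun ε hε => ?_
  -- The signals at which a given message works form an open set. By Lindelöf countably many
  -- messages suffice, and sending the first that works is measurable.
  let O : unitInterval → Set unitInterval :=
    fun m => {s | M.privateUtility (σ.afterMessage m) s < h s + ε}
  have hO : ∀ m, IsOpen (O m) := fun m => by
    refine isOpen_lt ?_ (hcont.add continuous_const)
    simp only [privateUtility_eq]
    fun_prop
  obtain ⟨T, hTc, hT⟩ := TopologicalSpace.isOpen_iUnion_countable O hO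
  have hcov : ∀ s, ∃ m ∈ T, s ∈ O m := fun s => by
    obtain ⟨m, hm⟩ := hh s ε hε
    have : s ∈ ⋃ m, O m := mem_iUnion.2 ⟨m, hm⟩
    rw [← hT] at this
    simpa using this
  obtain ⟨m₀, hm₀, -⟩ := hcov 0
  obtain ⟨e, he⟩ := hTc.exists_eq_range ⟨m₀, hm₀⟩
  have hfind : ∀ s, ∃ n, s ∈ O (e n) := fun s => by
    obtain ⟨m, hm, hs⟩ := hcov s
    rw [he] at hm
    obtain ⟨n, rfl⟩ := hm
    exact ⟨n, hs⟩
  have hr : Measurable fun s => e (Nat.find (hfind s)) :=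
    Measurable.find (f := fun n _ => e n) (fun n => measurable_const)
      (fun n => (hO (e n)).measurableSet) hfind
  refine (ciInf_le (M.bddBelow_expectedUtility σ) ⟨Kernel.deterministic _ hr, inferInstance⟩).trans ?_
  rw [expectedUtility_deterministic]
  have hadd : ∫ s, (h s + ε) ∂M.τ = ∫ s, h s ∂M.τ + ε := by
    rw [integral_add hi (integrable_const _)]
    simp
  rw [← hadd]
  exact integral_mono (M.integrable_privateUtility_afterMessage σ hr)
    (hi.add (integrable_const _)) fun s => (Nat.find_spec (hfind s)).le

end Model
-- Supporting lines of a strictly convex function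
/-- `k` selects, continuously, the slopes of lines that support `U` strictly from below. -/
structure SupportSlopes (U k : unitInterval → ℝ) : Prop where
  continuous_value : Continuous U
  continuous_slope : Continuous k
  support : ∀ x y : unitInterval, x ≠ y → U x + k x * ((y : ℝ) - x) < U y

/-- The supporting line of `U` at `μ`, evaluated at `x`. -/
def supportLine (U k : unitInterval → ℝ) (μ x : unitInterval) : ℝ := U μ + k μ * ((x : ℝ) - μ)

/-- The point of `[a, b]` closest to `s`. -/
def clamp (a b s : unitInterval) : unitInterval := max a (min b s)

theorem continuous_clamp (a b : unitInterval) : Continuous (clamp a b) := by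
  unfold clamp; fun_prop

theorem clamp_of_lt {a b s : unitInterval} (h : s < a) : clamp a b s = a :=
  max_eq_left ((min_le_right b s).trans h.le)

theorem clamp_of_mem {a b s : unitInterval} (h : s ∈ Icc a b) : clamp a b s = s := by
  rw [clamp, min_eq_right h.2, max_eq_right h.1]

theorem clamp_of_gt {a b s : unitInterval} (hab : a ≤ b) (h : b < s) : clamp a b s = b := by
  rw [clamp, min_eq_left h.le, max_eq_right hab]

theorem clamp_mem {a b : unitInterval} (hab : a ≤ b) (s : unitInterval) : clamp a b s ∈ Icc a b :=
  ⟨le_max_left _ _, max_le hab (min_le_left _ _)⟩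

/-- Payoff of the trust interval `[a, b]` when the tangent payoffs are those of `U` and an aligned
report has probability `α`. -/
noncomputable def intervalValue (α : ℝ) (ν : Measure unitInterval) (U k : unitInterval → ℝ)
    (a b : unitInterval) : ℝ :=
  α * ∫ s, supportLine U k (clamp a b s) s ∂ν +
    (1 - α) * ∫ s, min (supportLine U k a s) (supportLine U k b s) ∂ν

theorem integrable_of_continuous {ν : Measure unitInterval} [IsFiniteMeasure ν]
    {h : unitInterval → ℝ} (hc : Continuous h) : Integrable h ν :=
  hc.integrable_of_hasCompactSupport (HasCompactSupport.of_compactSpace h)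

theorem integral_supportLine (U k : unitInterval → ℝ) (ν : Measure unitInterval)
    [IsProbabilityMeasure ν] (μ : unitInterval) :
    ∫ s, supportLine U k μ s ∂ν = U μ + k μ * (∫ s, (s : ℝ) ∂ν - μ) := by
  unfold supportLine
  rw [integral_add (integrable_const _) (integrable_of_continuous (by fun_prop)),
    integral_const_mul, integral_sub (integrable_of_continuous (by fun_prop)) (integrable_const _)]
  simp

theorem intervalValue_self (α : ℝ) (U k : unitInterval → ℝ) (ν : Measure unitInterval)
    [IsProbabilityMeasure ν] (μ : unitInterval) :
    intervalValue α ν U k μ μ = U μ + k μ * (∫ s, (s : ℝ) ∂ν - μ) := by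
  have hc : ∀ s, clamp μ μ s = μ := fun s => le_antisymm (clamp_mem le_rfl s).2 (clamp_mem le_rfl s).1
  simp only [intervalValue, hc, min_self]
  rw [integral_supportLine]
  ring

namespace SupportSlopes

variable {U k : unitInterval → ℝ} (h : SupportSlopes U k)
include h

theorem supportLine_le (μ x : unitInterval) : supportLine U k μ x ≤ U x := by
  rcases eq_or_ne μ x with rfl | hne
  · simp [supportLine]
  · exact (h.support μ x hne).le

/-- Two lines differ by an affine function of slope `k ν - k μ`, which is nonnegative at `ν`, where
the second line touches `U`. -/
theorem supportLine_add_le (μ ν x : unitInterval) :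
    supportLine U k μ x + (k ν - k μ) * ((x : ℝ) - ν) ≤ supportLine U k ν x := by
  have := h.supportLine_le μ ν
  unfold supportLine at *
  linarith

theorem strictMono : StrictMono k := fun μ ν hlt => by
  have h1 := h.support μ ν hlt.ne
  have h2 := h.support ν μ hlt.ne'
  have h3 : (0 : ℝ) < ν - μ := sub_pos.2 hlt
  by_contra! hle
  nlinarith

theorem supportLine_antitone_of_le {μ ν x : unitInterval} (hμν : μ ≤ ν) (hx : x ≤ μ) :
    supportLine U k ν x ≤ supportLine U k μ x := by
  have h1 := h.supportLine_le ν μ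
  have h2 := h.strictMono.monotone hμν
  have h3 : (x : ℝ) ≤ μ := hx
  unfold supportLine at *
  nlinarith

theorem supportLine_monotone_of_ge {μ ν x : unitInterval} (hμν : μ ≤ ν) (hx : ν ≤ x) :
    supportLine U k μ x ≤ supportLine U k ν x := by
  have h1 := h.supportLine_le μ ν
  have h2 := h.strictMono.monotone hμν
  have h3 : (ν : ℝ) ≤ x := hx
  unfold supportLine at *
  nlinarith

theorem min_le_supportLine {a b μ : unitInterval} (hμ : μ ∈ Icc a b) (x : unitInterval) :
    min (supportLine U k a x) (supportLine U k b x) ≤ supportLine U k μ x := by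
  rcases le_total x μ with hx | hx
  · exact (min_le_right _ _).trans (h.supportLine_antitone_of_le hμ.2 hx)
  · exact (min_le_left _ _).trans (h.supportLine_monotone_of_ge hμ.1 hx)

theorem continuous_supportLine {a b : unitInterval → unitInterval} (ha : Continuous a)
    (hb : Continuous b) : Continuous fun x => supportLine U k (a x) (b x) := by
  have h1 := h.continuous_value
  have h2 := h.continuous_slope
  unfold supportLine
  fun_prop

/-- Raise the line until it touches `U`: this happens where `k` equals `q`, or at an endpoint if `q`
is outside the range of `k`. In the endpoint case the slopes may differ, but only in one direction.
-/
theorem exists_supportLine_ge {p q : ℝ} (hp : ∀ x : unitInterval, p + q * x ≤ U x) :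
    ∃ μ : unitInterval, (∀ x : unitInterval, p + q * x ≤ supportLine U k μ x) ∧
      (0 < μ → k μ ≤ q) ∧ (μ < 1 → q ≤ k μ) := by
  unfold supportLine
  rcases lt_or_ge q (k 0) with h0 | h0
  · refine ⟨0, fun x => ?_, fun h => absurd h (lt_irrefl _), fun _ => h0.le⟩
    have := hp 0
    have := x.2.1
    simp only [Icc.coe_zero] at *
    nlinarith
  rcases lt_or_ge (k 1) q with h1 | h1
  · refine ⟨1, fun x => ?_, fun _ => h1.le, fun h => absurd h (lt_irrefl _)⟩
    have := hp 1
    have := x.2.2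
    simp only [Icc.coe_one] at *
    nlinarith
  obtain ⟨μ, rfl⟩ := mem_range_of_exists_le_of_exists_ge h.continuous_slope ⟨0, h0⟩ ⟨1, h1⟩
  refine ⟨μ, fun x => ?_, fun _ => le_rfl, fun _ => le_rfl⟩
  have := hp μ
  linarith

/-- A family of lines below `U` is dominated by the supporting lines at the points of an interval:
each of these lies above the lower envelope `g` of the family, and at each signal the best
of them lies above any line of the family, strictly unless both touch `U` at the same point. -/
theorem exists_interval {g : unitInterval → ℝ} {p₀ q₀ : ℝ}
    (h0 : ∀ x : unitInterval, p₀ + q₀ * x ≤ U x) (hg0 : ∀ x : unitInterval, g x ≤ p₀ + q₀ * x) :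
    ∃ a b : unitInterval, a ≤ b ∧ (∀ x, g x ≤ supportLine U k a x) ∧
      (∀ x, g x ≤ supportLine U k b x) ∧
      ∀ p q : ℝ, (∀ x : unitInterval, p + q * x ≤ U x) → (∀ x : unitInterval, g x ≤ p + q * x) →
        ∀ s : unitInterval, p + q * s ≤ supportLine U k (clamp a b s) s ∧
          (p + q * s = supportLine U k (clamp a b s) s →
            p + q * (clamp a b s : unitInterval) = U (clamp a b s)) := by
  let I : Set unitInterval := {μ | ∀ x, g x ≤ supportLine U k μ x}
  have hI : IsCompact I := by
    refine IsClosed.isCompact ?_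
    simp only [I, Set.ofPred_forall]
    exact isClosed_iInter fun x => isClosed_le continuous_const
      (h.continuous_supportLine continuous_id continuous_const)
  have hne : I.Nonempty := by
    obtain ⟨μ, hμ, -⟩ := h.exists_supportLine_ge h0
    exact ⟨μ, fun x => (hg0 x).trans (hμ x)⟩
  obtain ⟨a, haI, ha⟩ := hI.exists_isLeast hne
  obtain ⟨b, hbI, hb⟩ := hI.exists_isGreatest hne
  have hab : a ≤ b := ha hbI
  refine ⟨a, b, hab, haI, hbI, fun p q hU hg s => ?_⟩
  obtain ⟨μ, hμ, hμ0, hμ1⟩ := h.exists_supportLine_ge hU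
  have hμI : μ ∈ I := fun x => (hg x).trans (hμ x)
  rcases lt_or_ge s a with hs | hs
  · rw [clamp_of_lt hs]
    -- The line is at least as steep as the one at `a`, and not above `U` at `a`. So it is no higher
    -- at `s < a`, and equality there forces contact at `a`.
    have hk : k a ≤ q := (h.strictMono.monotone (ha hμI)).trans
      (hμ0 ((s.2.1.trans_lt hs : (0 : unitInterval) < a).trans_le (ha hμI)))
    have h1 := hU a
    have h2 : (s : ℝ) < a := hs
    unfold supportLine
    exact ⟨by nlinarith, fun _ => by nlinarith⟩
  rcases lt_or_ge b s with hs' | hs'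
  · rw [clamp_of_gt hab hs']
    have hk : q ≤ k b := (hμ1 ((hb hμI).trans_lt (hs'.trans_le s.2.2))).trans
      (h.strictMono.monotone (hb hμI))
    have h1 := hU b
    have h2 : (b : ℝ) < s := hs'
    unfold supportLine
    exact ⟨by nlinarith, fun _ => by nlinarith⟩
  · rw [clamp_of_mem ⟨hs, hs'⟩]
    simp [supportLine, hU s]

/-! ### Trust intervals reaching `0` or `1` are not optimal -/

section Value

variable {ν : Measure unitInterval} [IsProbabilityMeasure ν] {α : ℝ}

/-- A constant reply pays its line evaluated at the mean, where the line touching `U` at the mean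
beats all others. -/
theorem intervalValue_self_lt {μ p : unitInterval} (hp : (p : ℝ) = ∫ s, (s : ℝ) ∂ν) (hne : μ ≠ p) :
    intervalValue α ν U k μ μ < intervalValue α ν U k p p := by
  rw [intervalValue_self, intervalValue_self, ← hp]
  have := h.support μ p hne
  linarith

/-- Cutting off the beliefs near `0` improves a trust interval that contains `0`. -/
theorem exists_intervalValue_lt_left [ν.IsOpenPosMeasure] (hα0 : 0 ≤ α) (hα1 : α < 1)
    {b : unitInterval} (hb : 0 < b) :
    ∃ a : unitInterval, 0 < a ∧ a < b ∧ intervalValue α ν U k 0 b < intervalValue α ν U k a b := by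
  have hb' : (0 : ℝ) < b := hb
  set η : ℝ := U b - supportLine U k 0 b with hη
  have hη0 : 0 < η := sub_pos.2 (h.support 0 b hb.ne)
  set K : ℝ := k b - k 0 with hK
  have hK0 : 0 < K := sub_pos.2 (h.strictMono hb)
  -- On `S` the line at `0` must rise by at least `δ * c0` (whence `1 / 4`), and this must stay
  -- below the gap to the line at `b` (whence `η / (2 * K)`, as `δ ≤ K`).
  set c0 : ℝ := min (1 / 4) (η / (2 * K))
  have hc0pos : 0 < c0 := lt_min (by norm_num) (by positivity)
  -- Signals near `1`, at which the line at `b` exceeds the line at `0` by more than `η / 2`.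
  set S : Set unitInterval := {x | (1 / 2 : ℝ) < x ∧ K * (1 - x) < η / 2} with hS
  have hSo : IsOpen S :=
    (isOpen_lt continuous_const continuous_subtype_val).inter
      (isOpen_lt (by fun_prop : Continuous fun x : unitInterval => K * (1 - (x : ℝ)))
        continuous_const)
  have hπ : 0 < ν.real S := by
    refine ENNReal.toReal_pos (hSo.measure_pos ν ⟨1, ?_, ?_⟩).ne' (measure_ne_top _ _)
    · norm_num
    · simpa using hη0
  -- Loss `δ * ε` and gain `(1 - α) * δ * c0 * ν.real S` are both proportional to `δ`, so no
  -- estimate of `δ` in terms of `ε` is needed.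
  set ε : ℝ := min (min (b / 2) (1 / 4)) ((1 - α) * c0 * ν.real S / 2) with hε
  have h1α : 0 < 1 - α := by linarith
  have hgain : 0 < (1 - α) * c0 * ν.real S := by positivity
  have hε0 : 0 < ε := lt_min (lt_min (by positivity) (by norm_num)) (by positivity)
  have hεb : ε ≤ b / 2 := (min_le_left _ _).trans (min_le_left _ _)
  have hε4 : ε ≤ 1 / 4 := (min_le_left _ _).trans (min_le_right _ _)
  have hεg : ε < (1 - α) * c0 * ν.real S := (min_le_right _ _).trans_lt (by linarith)
  let a : unitInterval := ⟨ε, hε0.le, by linarith⟩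
  have ha : (a : ℝ) = ε := rfl
  have ha0 : 0 < a := hε0
  have hab : a < b := show ε < b by linarith
  set δ : ℝ := k a - k 0 with hδ
  have hδ0 : 0 < δ := sub_pos.2 (h.strictMono ha0)
  have hδK : δ ≤ K := sub_le_sub_right (h.strictMono hab).le _
  refine ⟨a, ha0, hab, ?_⟩
  have hclamp : ∀ c : unitInterval, Integrable (fun s => supportLine U k (clamp c b s) s) ν :=
    fun c => integrable_of_continuous
      (h.continuous_supportLine (continuous_clamp _ _) continuous_id)
  have hmin : ∀ c : unitInterval,
      Integrable (fun s => min (supportLine U k c s) (supportLine U k b s)) ν :=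
    fun c => integrable_of_continuous
      ((h.continuous_supportLine continuous_const continuous_id).min
        (h.continuous_supportLine continuous_const continuous_id))
  have hloss : ∫ s, supportLine U k (clamp 0 b s) s ∂ν - δ * ε ≤
      ∫ s, supportLine U k (clamp a b s) s ∂ν := by
    have := integral_mono ((hclamp 0).sub (integrable_const (δ * ε))) (hclamp a) fun s => ?_
    · rw [integral_sub' (hclamp 0) (integrable_const _)] at this
      simpa using this
    · change supportLine U k (clamp 0 b s) s - δ * ε ≤ supportLine U k (clamp a b s) s
      rcases lt_or_ge s a with hs | hs
      · rw [clamp_of_lt hs, clamp_of_mem ⟨s.2.1, (hs.trans hab).le⟩]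
        have h1 := h.supportLine_le s a
        have h2 : k 0 ≤ k s := h.strictMono.monotone s.2.1
        have h3 : (s : ℝ) < ε := hs
        have h4 : (0 : ℝ) ≤ s := s.2.1
        unfold supportLine at *
        nlinarith [mul_nonneg (sub_nonneg.2 h2) (sub_nonneg.2 h3.le), mul_nonneg hδ0.le h4]
      · have : clamp 0 b s = clamp a b s := by
          rw [clamp, clamp, max_eq_right (le_min hab.le hs),
            max_eq_right (show (0 : unitInterval) ≤ min b s from (min b s).2.1)]
        rw [this]
        have := mul_pos hδ0 hε0
        linarith
  have hadv : ∫ s, min (supportLine U k 0 s) (supportLine U k b s) ∂ν + δ * c0 * ν.real S ≤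
      ∫ s, min (supportLine U k a s) (supportLine U k b s) ∂ν := by
    have hind : Integrable (S.indicator fun _ => δ * c0) ν :=
      (integrable_const _).indicator hSo.measurableSet
    have := integral_mono ((hmin 0).add hind) (hmin a) fun s => ?_
    · rw [integral_add' (hmin 0) hind, integral_indicator_const _ hSo.measurableSet, smul_eq_mul,
        mul_comm (ν.real S)] at this
      exact this
    · change min (supportLine U k 0 s) (supportLine U k b s) + S.indicator (fun _ => δ * c0) s ≤
        min (supportLine U k a s) (supportLine U k b s)
      by_cases hs : s ∈ S
      · rw [indicator_of_mem hs]
        obtain ⟨hs1, hs2⟩ := hs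
        have h1 : supportLine U k 0 s + δ * (s - ε) ≤ supportLine U k a s :=
          h.supportLine_add_le 0 a s
        have h2 : δ * c0 ≤ δ * (1 / 4) := mul_le_mul_of_nonneg_left (min_le_left _ _) hδ0.le
        have h3 : δ * c0 ≤ η / 2 := by
          calc δ * c0 ≤ K * (η / (2 * K)) :=
                mul_le_mul hδK (min_le_right _ _) hc0pos.le hK0.le
            _ = η / 2 := by field_simp
        have h4 : supportLine U k b s = supportLine U k 0 s + η + K * (s - b) := by
          simp only [hη, hK, supportLine]
          ring
        have h5 := mul_le_mul_of_nonneg_left (show (1 / 4 : ℝ) ≤ s - ε by linarith) hδ0.le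
        have h6 := mul_le_mul_of_nonneg_left (show (s : ℝ) - 1 ≤ s - b by linarith [b.2.2]) hK0.le
        refine le_min ?_ ?_
        · linarith [min_le_left (supportLine U k 0 s) (supportLine U k b s)]
        · linarith [min_le_left (supportLine U k 0 s) (supportLine U k b s)]
      -- Off `S` the minimum does not fall: left of `a` the line at `b` is below the line at `a`,
      -- and right of `a` the line at `a` is above the one at `0`.
      · rw [indicator_of_notMem hs, add_zero]
        rcases le_total s a with hsa | hsa
        · exact le_min ((min_le_right _ _).trans (h.supportLine_antitone_of_le hab.le hsa))
            (min_le_right _ _)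
        · exact min_le_min_right _ (h.supportLine_monotone_of_ge ha0.le hsa)
  unfold intervalValue
  have e1 := mul_le_mul_of_nonneg_left hloss hα0
  have e2 := mul_le_mul_of_nonneg_left hadv h1α.le
  have e3 := mul_lt_mul_of_pos_left hεg hδ0
  have e4 : α * (δ * ε) ≤ δ * ε := mul_le_of_le_one_left (by positivity) hα1.le
  linarith

/-- Cutting off the beliefs near `1` improves a trust interval that contains `1`. -/
theorem exists_intervalValue_lt_right [ν.IsOpenPosMeasure] (hα0 : 0 ≤ α) (hα1 : α < 1)
    {a : unitInterval} (ha : a < 1) :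
    ∃ b : unitInterval, a < b ∧ b < 1 ∧ intervalValue α ν U k a 1 < intervalValue α ν U k a b := by
  -- Reflection `x ↦ 1 - x` swaps the two ends and reverses the sign of the slopes.
  let V : unitInterval → ℝ := fun x => U (unitInterval.symm x)
  let l : unitInterval → ℝ := fun x => -k (unitInterval.symm x)
  have hV : SupportSlopes V l := by
    refine ⟨h.continuous_value.comp unitInterval.continuous_symm,
      (h.continuous_slope.comp unitInterval.continuous_symm).neg, fun x y hxy => ?_⟩
    have := h.support (unitInterval.symm x) (unitInterval.symm y)
      fun e => hxy (unitInterval.symm_bijective.1 e)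
    simp only [unitInterval.coe_symm_eq] at this
    simp only [V, l]
    linarith
  have hline : ∀ μ x, supportLine V l (unitInterval.symm μ) (unitInterval.symm x) =
      supportLine U k μ x := fun μ x => by
    simp only [supportLine, V, l, unitInterval.symm_symm, unitInterval.coe_symm_eq]
    ring
  have hclamp : ∀ c d s : unitInterval, c ≤ d → clamp (unitInterval.symm d) (unitInterval.symm c)
      (unitInterval.symm s) = unitInterval.symm (clamp c d s) := fun c d s hcd => by
    have hanti : ∀ {x y : unitInterval}, x < y → unitInterval.symm y < unitInterval.symm x :=
      fun hxy => unitInterval.strictAnti_symm hxy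
    rcases lt_or_ge s c with hs | hs
    · rw [clamp_of_lt hs, clamp_of_gt (unitInterval.strictAnti_symm.antitone hcd) (hanti hs)]
    rcases lt_or_ge d s with hs' | hs'
    · rw [clamp_of_gt hcd hs', clamp_of_lt (hanti hs')]
    · rw [clamp_of_mem ⟨hs, hs'⟩, clamp_of_mem ⟨unitInterval.strictAnti_symm.antitone hs',
        unitInterval.strictAnti_symm.antitone hs⟩]
  have hval : ∀ c d : unitInterval, c ≤ d → intervalValue α (ν.map unitInterval.symm) V l
      (unitInterval.symm d) (unitInterval.symm c) = intervalValue α ν U k c d := fun c d hcd => by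
    have hmap : ∀ f : unitInterval → ℝ, ∫ s, f s ∂ν.map unitInterval.symm =
        ∫ s, f (unitInterval.symm s) ∂ν := fun f =>
      integral_map_equiv (μ := ν) unitInterval.symmMeasurableEquiv f
    unfold intervalValue
    rw [hmap, hmap]
    simp only [hclamp _ _ _ hcd, hline, min_comm (supportLine U k d _)]
  have hsymm : Measurable unitInterval.symm := unitInterval.continuous_symm.measurable
  have : IsProbabilityMeasure (ν.map unitInterval.symm) :=
    Measure.isProbabilityMeasure_map hsymm.aemeasurable
  have : (ν.map unitInterval.symm).IsOpenPosMeasure :=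
    unitInterval.continuous_symm.isOpenPosMeasure_map unitInterval.symm_bijective.2
  obtain ⟨b, hb0, hba, hlt⟩ := hV.exists_intervalValue_lt_left (ν := ν.map unitInterval.symm)
    hα0 hα1 (b := unitInterval.symm a) (unitInterval.symm_one ▸ unitInterval.strictAnti_symm ha)
  have hab : a < unitInterval.symm b := by
    simpa using unitInterval.strictAnti_symm hba
  refine ⟨unitInterval.symm b, hab, ?_, ?_⟩
  · simpa using unitInterval.strictAnti_symm hb0
  · rw [← hval a 1 ha.le, ← hval a _ hab.le, unitInterval.symm_one, unitInterval.symm_symm]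
    exact hlt

/-- A trust interval with an endpoint `0` or `1` is worse than some trust interval in the
interior. -/
theorem exists_interior_intervalValue_lt [ν.IsOpenPosMeasure] (hα0 : 0 ≤ α) (hα1 : α < 1)
    {a b p : unitInterval} (hab : a ≤ b) (hp : (p : ℝ) = ∫ s, (s : ℝ) ∂ν) (hp0 : 0 < p)
    (hp1 : p < 1) (hend : a = 0 ∨ b = 1) :
    ∃ a' b' : unitInterval, 0 < a' ∧ a' ≤ b' ∧ b' < 1 ∧
      intervalValue α ν U k a b < intervalValue α ν U k a' b' := by
  have hself : ∀ c : unitInterval, c ≠ p → ∃ a' b' : unitInterval, 0 < a' ∧ a' ≤ b' ∧ b' < 1 ∧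
      intervalValue α ν U k c c < intervalValue α ν U k a' b' := fun c hc =>
    ⟨p, p, hp0, le_rfl, hp1, h.intervalValue_self_lt hp hc⟩
  have hright : ∀ c : unitInterval, 0 < c → c < 1 → ∃ a' b' : unitInterval, 0 < a' ∧ a' ≤ b' ∧
      b' < 1 ∧ intervalValue α ν U k c 1 < intervalValue α ν U k a' b' := fun c hc0 hc1 => by
    obtain ⟨b', hb', hb1, hlt⟩ := h.exists_intervalValue_lt_right (ν := ν) hα0 hα1 hc1
    exact ⟨c, b', hc0, hb'.le, hb1, hlt⟩
  rcases eq_or_ne a 0 with rfl | ha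
  · rcases eq_or_ne b 0 with rfl | hb
    · exact hself 0 hp0.ne
    obtain ⟨a', ha'0, ha'b, hlt⟩ := h.exists_intervalValue_lt_left (ν := ν) hα0 hα1
      (unitInterval.pos_iff_ne_zero.2 hb)
    rcases eq_or_ne b 1 with rfl | hb1
    · obtain ⟨a'', b'', h1, h2, h3, h4⟩ := hright a' ha'0 ha'b
      exact ⟨a'', b'', h1, h2, h3, hlt.trans h4⟩
    · exact ⟨a', b, ha'0, ha'b.le, unitInterval.lt_one_iff_ne_one.2 hb1, hlt⟩
  · obtain rfl : b = 1 := hend.resolve_left ha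
    rcases eq_or_ne a 1 with rfl | ha1
    · exact hself 1 hp1.ne'
    · exact hright a (unitInterval.pos_iff_ne_zero.2 ha) (unitInterval.lt_one_iff_ne_one.2 ha1)

end Value
end SupportSlopes
-- The indirect utility and its tangents
namespace Model

variable {A Θ : Type*} [MetricSpace A] [MeasurableSpace A]
  [MetricSpace Θ] [MeasurableSpace Θ] (M : Model A Θ)

theorem privateUtility_eq_add_mul (ρ : PrivateStrategy A Θ) (x : ℝ) :
    M.privateUtility ρ x =
      M.stateUtility ρ 0 + (M.stateUtility ρ 1 - M.stateUtility ρ 0) * x := by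
  rw [privateUtility_eq]; ring

/-- The value and the slope of the indirect utility determine the payoffs of a Bayes-optimal private
strategy. -/
theorem IsBayesOptimal.stateUtility_sub_eq_deriv {ρ : PrivateStrategy A Θ} {μ : unitInterval}
    (hμ : μ ∈ Ioo (0 : unitInterval) 1) (hdiff : DifferentiableAt ℝ M.indirectUtility μ)
    (hρ : M.IsBayesOptimal ρ μ) :
    M.stateUtility ρ 1 - M.stateUtility ρ 0 = deriv M.indirectUtility μ := by
  have hd : HasDerivAt (fun x => M.indirectUtility x - M.privateUtility ρ x)
      (deriv M.indirectUtility μ - (M.stateUtility ρ 1 - M.stateUtility ρ 0)) μ := by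
    refine hdiff.hasDerivAt.sub ?_
    rw [show M.privateUtility ρ = _ from funext (M.privateUtility_eq_add_mul ρ)]
    simpa using ((hasDerivAt_id (μ : ℝ)).const_mul
      (M.stateUtility ρ 1 - M.stateUtility ρ 0)).const_add (M.stateUtility ρ 0)
  -- Envelope argument: the difference is nonnegative and vanishes at `μ`.
  have hmin : IsLocalMin (fun x => M.indirectUtility x - M.privateUtility ρ x) μ := by
    filter_upwards [Ioo_mem_nhds (show (0 : ℝ) < μ from hμ.1) (show (μ : ℝ) < 1 from hμ.2)]
      with x hx
    rw [(M.isBayesOptimal_iff ρ μ).1 hρ, sub_self, sub_nonneg]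
    exact M.privateUtility_le_indirectUtility ρ ⟨x, hx.1.le, hx.2.le⟩
  linarith [hmin.hasDerivAt_eq_zero hd]

theorem IsBayesOptimal.stateUtility_eq {ρ ρ' : PrivateStrategy A Θ} {μ : unitInterval}
    (hμ : μ ∈ Ioo (0 : unitInterval) 1) (hdiff : DifferentiableAt ℝ M.indirectUtility μ)
    (hρ : M.IsBayesOptimal ρ μ) (hρ' : M.IsBayesOptimal ρ' μ) (ω : Fin 2) :
    M.stateUtility ρ ω = M.stateUtility ρ' ω := by
  have h1 := hρ.stateUtility_sub_eq_deriv M hμ hdiff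
  have h2 := hρ'.stateUtility_sub_eq_deriv M hμ hdiff
  have h3 := ((M.isBayesOptimal_iff ρ μ).1 hρ).trans ((M.isBayesOptimal_iff ρ' μ).1 hρ').symm
  have h4 : M.stateUtility ρ 1 - M.stateUtility ρ 0 =
    M.stateUtility ρ' 1 - M.stateUtility ρ' 0 := h1.trans h2.symm
  simp only [privateUtility_eq_add_mul, h4, add_left_inj] at h3
  fin_cases ω
  · exact h3
  · change M.stateUtility ρ 1 = M.stateUtility ρ' 1
    linarith

/-- The derivative is monotone and bounded, because differences of state payoffs are, so it extends
continuously to `0` and `1`. Replies optimal at `0` or `1` are unconstrained in the other state, so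
the tangent property is asserted for interior beliefs only. -/
theorem exists_supportSlopes [CompactSpace A] [BorelSpace A] [Nonempty A]
    (hconv : StrictConvexOn ℝ (Icc 0 1) M.indirectUtility)
    (hdiff : DifferentiableOn ℝ M.indirectUtility (Ioo 0 1))
    (hcont : ContinuousOn (deriv M.indirectUtility) (Ioo 0 1)) :
    ∃ k : unitInterval → ℝ, SupportSlopes (fun x => M.indirectUtility x) k ∧
      ∀ μ ∈ Ioo (0 : unitInterval) 1, ∀ ρ, M.IsBayesOptimal ρ μ → ∀ x : unitInterval,
        M.privateUtility ρ x = supportLine (fun x => M.indirectUtility x) k μ x := by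
  obtain ⟨σ, hσ⟩ := M.exists_bayesOptimal_strategy
  obtain ⟨C, hC0, hC⟩ := M.exists_stateUtility_bound
  have hd : ∀ x ∈ Ioo (0 : ℝ) 1, DifferentiableAt ℝ M.indirectUtility x := fun x hx =>
    hdiff.differentiableAt (isOpen_Ioo.mem_nhds hx)
  have hslope : ∀ ρ : PrivateStrategy A Θ, |M.stateUtility ρ 1 - M.stateUtility ρ 0| ≤ 2 * C :=
    fun ρ => by linarith [abs_sub (M.stateUtility ρ 1) (M.stateUtility ρ 0), hC ρ 0, hC ρ 1]
  have hderiv : ∀ x ∈ Ioo (0 : ℝ) 1, |deriv M.indirectUtility x| ≤ 2 * C := fun x hx => by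
    have := (hσ ⟨x, hx.1.le, hx.2.le⟩).stateUtility_sub_eq_deriv M hx (hd x hx)
    rw [← this]
    exact hslope _
  have hmono : MonotoneOn (deriv M.indirectUtility) (Ioo 0 1) :=
    ((hconv.subset Ioo_subset_Icc_self (convex_Ioo 0 1)).strictMonoOn_deriv hd).monotoneOn
  have hne : (Ioo (0 : ℝ) 1).Nonempty := nonempty_Ioo.2 one_pos
  have hl := hmono.tendsto_nhdsWithin_Ioo_right hne
    ⟨-(2 * C), forall_mem_image.2 fun x hx => (abs_le.1 (hderiv x hx)).1⟩
  have hr := hmono.tendsto_nhdsWithin_Ioo_left hne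
    ⟨2 * C, forall_mem_image.2 fun x hx => (abs_le.1 (hderiv x hx)).2⟩
  let k : unitInterval → ℝ := fun x => extendFrom (Ioo 0 1) (deriv M.indirectUtility) x
  have hkc : Continuous k :=
    continuousOn_iff_continuous_domRestrict.1 (continuousOn_Icc_extendFrom_Ioo hcont hl hr)
  have hk : ∀ μ ∈ Ioo (0 : unitInterval) 1, k μ = deriv M.indirectUtility μ := fun μ hμ =>
    extendFrom_eq (subset_closure hμ) (hcont μ hμ)
  have htangent : ∀ μ ∈ Ioo (0 : unitInterval) 1, ∀ ρ, M.IsBayesOptimal ρ μ → ∀ x : unitInterval,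
      M.privateUtility ρ x = supportLine (fun x => M.indirectUtility x) k μ x := by
    intro μ hμ ρ hρ x
    have h1 := hρ.stateUtility_sub_eq_deriv M hμ (hd μ hμ)
    have h2 := (M.isBayesOptimal_iff ρ μ).1 hρ
    rw [privateUtility_eq_add_mul] at h2 ⊢
    rw [supportLine, hk μ hμ, ← h1, ← h2]
    ring
  have hUc : Continuous fun x : unitInterval => M.indirectUtility x := by
    refine (LipschitzWith.of_le_add_mul (Real.toNNReal (2 * C)) fun x y => ?_).continuous
    have h1 := (M.isBayesOptimal_iff _ x).1 (hσ x)
    have h2 := M.privateUtility_le_indirectUtility (σ.afterMessage x) y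
    have h3 := (le_abs_self _).trans ((abs_mul _ _).le.trans (mul_le_mul_of_nonneg_right
      (hslope (σ.afterMessage x)) (abs_nonneg ((x : ℝ) - y))))
    rw [privateUtility_eq_add_mul] at h1 h2
    rw [Real.coe_toNNReal _ (by positivity), Subtype.dist_eq, Real.dist_eq]
    linarith
  have hweak : ∀ x y : unitInterval,
      M.indirectUtility x + k x * ((y : ℝ) - x) ≤ M.indirectUtility y := by
    intro x y
    have hdense : Dense (Ioo (0 : unitInterval) 1) := fun z => by
      rw [closure_Ioo zero_ne_one]
      exact ⟨z.2.1, z.2.2⟩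
    refine hdense.induction
      (P := fun x => M.indirectUtility x + k x * ((y : ℝ) - x) ≤ M.indirectUtility y)
      (fun μ hμ => ?_) (isClosed_le (by fun_prop) continuous_const) x
    exact (htangent μ hμ _ (hσ μ) y).symm.le.trans (M.privateUtility_le_indirectUtility _ y)
  refine ⟨k, ⟨hUc, hkc, fun x y hxy => ?_⟩, htangent⟩
  -- Strict convexity at the midpoint, combined with weak support there, makes support at `y`
  -- strict.
  have hz := hconv.2 x.2 y.2 (fun e => hxy (Subtype.ext e)) (one_half_pos (α := ℝ))
    one_half_pos (add_halves 1)
  have hw := hweak x ⟨_, hconv.1 x.2 y.2 (one_half_pos (α := ℝ)).le one_half_pos.le (add_halves 1)⟩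
  simp only [smul_eq_mul] at hz hw
  linarith

end Model
-- Full support and changes on null sets of messages
instance isOpenPosMeasure_volume_unitInterval :
    (volume : Measure unitInterval).IsOpenPosMeasure := by
  refine ⟨fun S hS hne => ?_⟩
  have hdense : Dense (Ioo (0 : unitInterval) 1) := fun z => by
    rw [closure_Ioo zero_ne_one]
    exact ⟨z.2.1, z.2.2⟩
  obtain ⟨x, hx, hxS⟩ := hdense.exists_mem_open hS hne
  obtain ⟨V, hV, rfl⟩ := isOpen_induced_iff.1 hS
  have hpos : 0 < volume (V ∩ Ioo (0 : ℝ) 1) := (hV.inter isOpen_Ioo).measure_pos volume ⟨x, hxS, hx⟩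
  rw [unitInterval.volume_def, comap_subtype_coe_apply measurableSet_Icc]
  refine (hpos.trans_le (measure_mono fun y hy => ?_)).ne'
  exact ⟨⟨y, hy.2.1.le, hy.2.2.le⟩, hy.1, rfl⟩

theorem trustIntervalRule_of_clamp {A Θ : Type*} [MeasurableSpace A] [MeasurableSpace Θ]
    {R : PrivateStrategy A Θ → unitInterval → Prop} {σ : Strategy A Θ} {lo hi m : unitInterval}
    (hle : lo ≤ hi) (h : R (σ.afterMessage m) (clamp lo hi m)) : TrustIntervalRule R σ lo hi m :=
  ⟨fun hm => by rwa [clamp_of_mem hm] at h, fun hm => clamp_of_lt hm ▸ h, fun hm => clamp_of_gt hle hm ▸ h⟩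

namespace Strategy

variable {A Θ : Type*} [MeasurableSpace A] [MeasurableSpace Θ]

/-- The strategy that answers `m` as `σ` answers `r m`. -/
noncomputable def relabel (σ : Strategy A Θ) (r : unitInterval → unitInterval) (hr : Measurable r) :
    Strategy A Θ :=
  ⟨σ.1.comap (Prod.map r id) (hr.prodMap measurable_id), haveI := σ.2; inferInstance⟩

theorem afterMessage_congr {σ σ' : Strategy A Θ} {m : unitInterval}
    (h : ∀ θ, σ'.1 (m, θ) = σ.1 (m, θ)) : σ'.afterMessage m = σ.afterMessage m :=
  Subtype.ext (Kernel.ext h)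

theorem exists_piecewise (σ σ₁ : Strategy A Θ) {N : Set unitInterval} (hN : MeasurableSet N) :
    ∃ σ' : Strategy A Θ, (∀ m ∈ N, ∀ θ, σ'.1 (m, θ) = σ₁.1 (m, θ)) ∧
      ∀ m ∉ N, ∀ θ, σ'.1 (m, θ) = σ.1 (m, θ) := by
  classical
  have := σ.2
  have := σ₁.2
  refine ⟨⟨Kernel.piecewise (measurable_fst hN) σ₁.1 σ.1, inferInstance⟩,
    fun m hm θ => ?_, fun m hm θ => ?_⟩
  · exact if_pos hm
  · exact if_neg hm

end Strategy

namespace Model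

variable {A Θ : Type*} [MetricSpace A] [MeasurableSpace A]
  [MetricSpace Θ] [MeasurableSpace Θ] (M : Model A Θ)

instance isOpenPosMeasure_τ : M.τ.IsOpenPosMeasure := by
  refine (withDensity_absolutelyContinuous' M.density_measurable.ennreal_ofReal.aemeasurable
    (.of_forall fun s => ?_)).isOpenPosMeasure
  exact (ENNReal.ofReal_pos.2 (M.density_pos s)).ne'

theorem exists_prior : ∃ p : unitInterval, (p : ℝ) = ∫ s, (s : ℝ) ∂M.τ ∧ 0 < p ∧ p < 1 := by
  have hi : Integrable (fun s : unitInterval => (s : ℝ)) M.τ :=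
    integrable_of_continuous continuous_subtype_val
  have h0 : 0 < ∫ s, (s : ℝ) ∂M.τ :=
    integral_pos_of_integrable_nonneg_nonzero (x := (1 : unitInterval)) continuous_subtype_val hi
      (fun s => s.2.1) (by simp)
  have h1 : 0 < ∫ s, (1 - (s : ℝ)) ∂M.τ :=
    integral_pos_of_integrable_nonneg_nonzero (x := (0 : unitInterval)) (by fun_prop)
      ((integrable_const _).sub hi) (fun s => sub_nonneg.2 s.2.2) (by simp)
  rw [integral_sub (integrable_const _) hi] at h1
  simp only [integral_const, probReal_univ, smul_eq_mul, mul_one] at h1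
  exact ⟨⟨_, h0.le, by linarith⟩, rfl, h0, show (_ : ℝ) < 1 by linarith⟩

/-- Off the null messages `0` and `1` the rule only assigns interior beliefs: an end is used only by
messages strictly beyond it. -/
theorem ae_trustIntervalRule_mono {R : PrivateStrategy A Θ → unitInterval → Prop}
    {σ : Strategy A Θ} {lo hi : unitInterval} (hlo : lo < 1) (hhi : 0 < hi)
    (h : ∀ᵐ m ∂M.τ, TrustIntervalRule (fun ρ μ => M.IsBayesOptimal ρ μ) σ lo hi m)
    (hR : ∀ μ ∈ Ioo (0 : unitInterval) 1, ∀ ρ, M.IsBayesOptimal ρ μ → R ρ μ) :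
    ∀ᵐ m ∂M.τ, TrustIntervalRule R σ lo hi m := by
  filter_upwards [h, Measure.ae_ne M.τ 0, Measure.ae_ne M.τ 1] with m hm h0 h1
  have h0' : 0 < m := unitInterval.pos_iff_ne_zero.2 h0
  have h1' : m < 1 := unitInterval.lt_one_iff_ne_one.2 h1
  exact ⟨fun hmem => hR m ⟨h0', h1'⟩ _ (hm.1 hmem),
    fun hlt => hR lo ⟨h0'.trans hlt, hlo⟩ _ (hm.2.1 hlt),
    fun hlt => hR hi ⟨hhi, hlt.trans h1'⟩ _ (hm.2.2 hlt)⟩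

/-- An adversary may send `τ`-null messages with positive probability, so the condition on `N` is
imposed through `β`. -/
theorem outcomeLaw_congr {σ σ' : Strategy A Θ} {β : Reporting} {N : Set unitInterval}
    (hN : MeasurableSet N) (hβ : ∀ᵐ s ∂M.τ, β.1 s N = 0)
    (h : ∀ m ∉ N, ∀ θ, σ'.1 (m, θ) = σ.1 (m, θ)) :
    M.outcomeLaw β σ = M.outcomeLaw β σ' := by
  have := σ.2
  have := σ'.2
  have := β.2
  unfold outcomeLaw
  refine Finset.sum_congr rfl fun ω _ => ?_
  congr 1
  refine Measure.compProd_congr ?_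
  have hnull : ((M.τ.withDensity fun s => ENNReal.ofReal (prob s ω)).bind β.1) N = 0 := by
    rw [Measure.bind_apply hN (Kernel.aemeasurable _), lintegral_congr_ae
      (withDensity_absolutelyContinuous _ _ hβ), lintegral_zero]
  have hae := (Measure.quasiMeasurePreserving_fst (ν := M.f ω)).ae (measure_eq_zero_iff_ae_notMem.1 hnull)
  filter_upwards [hae] with p hp
  exact (h p.1 hp p.2).symm

theorem truthful_ae_eq_zero {N : Set unitInterval} (hN : MeasurableSet N) (h : M.τ N = 0) :
    ∀ᵐ s ∂M.τ, truthful.1 s N = 0 := by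
  filter_upwards [measure_eq_zero_iff_ae_notMem.1 h] with s hs
  simp [truthful, Kernel.id_apply, Measure.dirac_apply' _ hN, hs]

/-- A strategy that follows the rule of a trust interval almost surely can be corrected to one that
follows it after all messages. -/
theorem exists_modification {σ₀ σ : Strategy A Θ}
    (hσ₀ : ∀ m : unitInterval, M.IsBayesOptimal (σ₀.afterMessage m) m) {lo hi : unitInterval}
    (h : ∀ᵐ m ∂M.τ, M.IsBayesOptimal (σ.afterMessage m) (clamp lo hi m)) :
    ∃ (N : Set unitInterval) (σ' : Strategy A Θ), MeasurableSet N ∧ M.τ N = 0 ∧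
      (∀ m, M.IsBayesOptimal (σ'.afterMessage m) (clamp lo hi m)) ∧
      ∀ m ∉ N, ∀ θ, σ'.1 (m, θ) = σ.1 (m, θ) := by
  have hc : Measurable (clamp lo hi) := (continuous_clamp lo hi).measurable
  -- Comparing payoffs with the measurable selection `σ₀` makes the set of failures measurable.
  let N : Set unitInterval := {m | M.privateUtility (σ.afterMessage m) (clamp lo hi m) =
    M.privateUtility (σ₀.afterMessage (clamp lo hi m)) (clamp lo hi m)}ᶜ
  have hN : MeasurableSet N := (measurableSet_eq_fun
    (M.measurable_privateUtility_afterMessage σ measurable_id hc)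
    (M.measurable_privateUtility_afterMessage σ₀ hc hc)).compl
  have hiff : ∀ m, m ∉ N ↔ M.IsBayesOptimal (σ.afterMessage m) (clamp lo hi m) := fun m => by
    rw [isBayesOptimal_iff, ← (M.isBayesOptimal_iff _ _).1 (hσ₀ (clamp lo hi m))]
    simp [N]
  obtain ⟨σ', h1, h2⟩ := σ.exists_piecewise (σ₀.relabel _ hc) hN
  refine ⟨N, σ', hN, measure_eq_zero_iff_ae_notMem.2 (h.mono fun m hm => (hiff m).2 hm),
    fun m => ?_, h2⟩
  by_cases hm : m ∈ N
  · rw [Strategy.afterMessage_congr (h1 m hm)]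
    exact hσ₀ _
  · rw [Strategy.afterMessage_congr (h2 m hm)]
    exact (hiff m).1 hm

theorem isAdversarial_of_le {σ : Strategy A Θ} {β : Reporting}
    (h : M.α * M.expectedUtility truthful σ + (1 - M.α) * M.expectedUtility β σ ≤ M.worstCase σ) :
    M.IsAdversarial β σ := by
  refine h.antisymm ?_
  have := mul_le_mul_of_nonneg_left (ciInf_le (M.bddBelow_expectedUtility σ) β)
    (sub_nonneg.2 M.α_le_one)
  unfold worstCase
  linarith

/-! ### Payoffs of interior trust intervals -/

section Interior

variable {M} {k : unitInterval → ℝ}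
  (htan : ∀ μ ∈ Ioo (0 : unitInterval) 1, ∀ ρ, M.IsBayesOptimal ρ μ → ∀ x : unitInterval,
    M.privateUtility ρ x = supportLine (fun x => M.indirectUtility x) k μ x)
  {lo hi : unitInterval} (hlo : 0 < lo) (hle : lo ≤ hi) (hhi : hi < 1)
include htan hlo hle hhi

theorem privateUtility_eq_supportLine_clamp {σ : Strategy A Θ} {m : unitInterval}
    (h : M.IsBayesOptimal (σ.afterMessage m) (clamp lo hi m)) (x : unitInterval) :
    M.privateUtility (σ.afterMessage m) x =
      supportLine (fun x => M.indirectUtility x) k (clamp lo hi m) x :=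
  htan _ ⟨hlo.trans_le (clamp_mem hle m).1, (clamp_mem hle m).2.trans_lt hhi⟩ _ h x

variable (hk : SupportSlopes (fun x => M.indirectUtility x) k)
include hk

/-- Left of the interval, the tangents at its points are ordered with the one at `lo` highest, so
`lo` serves as the best response; likewise `hi` on the right. -/
theorem isTrustRegionStrategy {σ : Strategy A Θ}
    (h : ∀ m, M.IsBayesOptimal (σ.afterMessage m) (clamp lo hi m)) :
    M.IsTrustRegionStrategy σ (Icc lo hi) := by
  have hline := fun m => privateUtility_eq_supportLine_clamp htan hlo hle hhi (h m)
  refine ⟨isCompact_Icc, fun m hm => by simpa only [clamp_of_mem hm] using h m, fun m hm => ?_⟩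
  rcases lt_or_ge m lo with hm1 | hm1
  · refine ⟨lo, left_mem_Icc.2 hle, fun m' hm' => ?_, clamp_of_lt hm1 ▸ h m⟩
    rw [hline, hline, clamp_of_mem hm', clamp_of_mem (left_mem_Icc.2 hle)]
    exact hk.supportLine_antitone_of_le hm'.1 hm1.le
  · have hm2 : hi < m := not_le.1 fun hm2 => hm ⟨hm1, hm2⟩
    refine ⟨hi, right_mem_Icc.2 hle, fun m' hm' => ?_, clamp_of_gt hle hm2 ▸ h m⟩
    rw [hline, hline, clamp_of_mem hm', clamp_of_mem (right_mem_Icc.2 hle)]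
    exact hk.supportLine_monotone_of_ge hm'.2 hm2.le

/-- Any message induces a tangent at a point of `[lo, hi]`, which lies above the minimum of the two
extreme tangents. -/
theorem intervalValue_le_worstCase {σ : Strategy A Θ}
    (h : ∀ m, M.IsBayesOptimal (σ.afterMessage m) (clamp lo hi m)) :
    intervalValue M.α M.τ (fun x => M.indirectUtility x) k lo hi ≤ M.worstCase σ := by
  have hline := fun m => privateUtility_eq_supportLine_clamp htan hlo hle hhi (h m)
  unfold intervalValue worstCase
  rw [expectedUtility_truthful]
  simp only [hline]
  refine add_le_add_right (mul_le_mul_of_nonneg_left (M.integral_le_iInf_expectedUtility σ ?_ ?_)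
    (sub_nonneg.2 M.α_le_one)) _
  · exact integrable_of_continuous ((hk.continuous_supportLine continuous_const continuous_id).min
        (hk.continuous_supportLine continuous_const continuous_id))
  · intro s m
    rw [hline]
    exact hk.min_le_supportLine (clamp_mem hle m) s

end Interior

end Model
-- The cases `α = 1`, `α = 0` and `0 < α < 1`
namespace Model

variable {A Θ : Type*} [MetricSpace A] [MeasurableSpace A]
  [MetricSpace Θ] [MeasurableSpace Θ] (M : Model A Θ)

/-- An optimal strategy against an adviser who is aligned for sure answers almost all messages
optimally. -/
theorem exists_trustInterval_of_aligned {σ₀ σ : Strategy A Θ}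
    (hσ₀ : ∀ m : unitInterval, M.IsBayesOptimal (σ₀.afterMessage m) m) (hσ : M.IsOptimal σ)
    (hα : M.α = 1) :
    (∀ᵐ m ∂M.τ, M.IsBayesOptimal (σ.afterMessage m) (clamp 0 1 m)) ∧
      ∃ σ' : Strategy A Θ, M.IsTrustRegionStrategy σ' (Icc 0 1) ∧
        (∀ m, M.IsBayesOptimal (σ'.afterMessage m) (clamp 0 1 m)) ∧ M.Equivalent σ σ' := by
  have hclamp : ∀ m : unitInterval, clamp 0 1 m = m := fun m => clamp_of_mem ⟨m.2.1, m.2.2⟩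
  have hle : ∀ m : unitInterval,
      M.privateUtility (σ.afterMessage m) m ≤ M.privateUtility (σ₀.afterMessage m) m :=
    fun m => hσ₀ m _
  have hint := fun σ : Strategy A Θ => M.integrable_privateUtility_afterMessage σ measurable_id
  have hge := hσ σ₀
  simp only [worstCase, hα, sub_self, one_mul, zero_mul, add_zero, expectedUtility_truthful] at hge
  have hae := (integral_eq_iff_of_ae_le (hint σ) (hint σ₀) (.of_forall hle)).1
    ((integral_mono (hint σ) (hint σ₀) hle).antisymm hge)
  have hrule : ∀ᵐ m ∂M.τ, M.IsBayesOptimal (σ.afterMessage m) (clamp 0 1 m) := by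
    filter_upwards [hae] with m hm
    rw [hclamp, isBayesOptimal_iff, ← (M.isBayesOptimal_iff _ _).1 (hσ₀ m)]
    exact hm
  obtain ⟨N, σ', hN, hN0, hσ', hag⟩ := M.exists_modification hσ₀ hrule
  have hadv : ∀ σ : Strategy A Θ, M.IsAdversarial truthful σ := fun σ => by
    simp [IsAdversarial, worstCase, hα]
  refine ⟨hrule, σ', ⟨isCompact_Icc, fun m _ => by simpa only [hclamp] using hσ' m,
    fun m hm => absurd ⟨m.2.1, m.2.2⟩ hm⟩, hσ', truthful, truthful, hadv σ, hadv σ', ?_⟩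
  rw [totalLaw, totalLaw, M.outcomeLaw_congr hN (M.truthful_ae_eq_zero hN hN0) hag]

theorem integral_privateUtility (ρ : PrivateStrategy A Θ) :
    ∫ s : unitInterval, M.privateUtility ρ s ∂M.τ =
      M.privateUtility ρ (∫ s, (s : ℝ) ∂M.τ) := by
  simp only [privateUtility_eq_add_mul]
  rw [integral_add (integrable_const _) (integrable_of_continuous (by fun_prop)),
    integral_const_mul]
  simp

/-- An optimal strategy against an adviser who is never aligned ignores his messages. -/
theorem isBayesOptimal_prior_of_adversarial {σ₀ σ : Strategy A Θ}
    (hσ₀ : ∀ m : unitInterval, M.IsBayesOptimal (σ₀.afterMessage m) m) (hσ : M.IsOptimal σ)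
    (hα : M.α = 0) {p : unitInterval} (hp : (p : ℝ) = ∫ s, (s : ℝ) ∂M.τ) :
    (∀ m, M.IsBayesOptimal (σ.afterMessage m) p) ∧ M.Equivalent σ σ := by
  -- The competitor always answers as at the prior, which secures `U p` whatever is reported.
  have hge := hσ (σ₀.relabel (fun _ => p) measurable_const)
  simp only [worstCase, hα, sub_zero, one_mul, zero_mul, zero_add] at hge
  have h1 : M.privateUtility (σ₀.afterMessage p) p ≤ ⨅ β : Reporting,
      M.expectedUtility β (σ₀.relabel (fun _ => p) measurable_const) := by
    rw [hp, ← integral_privateUtility]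
    exact M.integral_le_iInf_expectedUtility _
      (M.integrable_privateUtility_afterMessage σ₀ measurable_const) fun s m => le_rfl
  -- Always sending `m` exposes the reply to `m` at the prior, so every single reply must be optimal
  -- there.
  let β : unitInterval → Reporting := fun m =>
    ⟨Kernel.deterministic (fun _ => m) measurable_const, inferInstance⟩
  have hβ : ∀ m, M.expectedUtility (β m) σ = M.privateUtility (σ.afterMessage m) p := fun m => by
    rw [expectedUtility_deterministic, integral_privateUtility, ← hp]
  have hadv : M.IsAdversarial (β 0) σ := by
    refine M.isAdversarial_of_le ?_
    simp only [worstCase, hα, sub_zero, one_mul, zero_mul, zero_add, hβ]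
    exact (hσ₀ p _).trans (h1.trans hge)
  refine ⟨fun m ρ => (hσ₀ p ρ).trans (h1.trans (hge.trans ?_)), β 0, β 0, hadv, hadv, rfl⟩
  exact (ciInf_le (M.bddBelow_expectedUtility σ) (β m)).trans (hβ m).le

/-- If the adviser may be aligned and may be adversarial, optimal strategies follow a trust
interval in the interior. -/
theorem exists_trustInterval_of_mixed {σ₀ σ : Strategy A Θ}
    (hσ₀ : ∀ m : unitInterval, M.IsBayesOptimal (σ₀.afterMessage m) m) (hσ : M.IsOptimal σ)
    (hα0 : 0 < M.α) (hα1 : M.α < 1) {k : unitInterval → ℝ}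
    (hk : SupportSlopes (fun x => M.indirectUtility x) k)
    (htan : ∀ μ ∈ Ioo (0 : unitInterval) 1, ∀ ρ, M.IsBayesOptimal ρ μ → ∀ x : unitInterval,
      M.privateUtility ρ x = supportLine (fun x => M.indirectUtility x) k μ x) :
    ∃ lo hi : unitInterval, 0 < lo ∧ lo ≤ hi ∧ hi < 1 ∧
      (∀ᵐ m ∂M.τ, M.IsBayesOptimal (σ.afterMessage m) (clamp lo hi m)) ∧
      ∃ σ' : Strategy A Θ, (∀ m, M.IsBayesOptimal (σ'.afterMessage m) (clamp lo hi m)) ∧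
        M.Equivalent σ σ' := by
  set U : unitInterval → ℝ := fun x => M.indirectUtility x
  have h1α : 0 < 1 - M.α := sub_pos.2 hα1
  obtain ⟨C, -, hC⟩ := M.exists_privateUtility_bound
  let g : unitInterval → ℝ := fun x => ⨅ m, M.privateUtility (σ.afterMessage m) x
  have hg : ∀ x m : unitInterval, g x ≤ M.privateUtility (σ.afterMessage m) x := fun x m =>
    ciInf_le ⟨-C, forall_mem_range.2 fun m => (abs_le.1 (hC _ x)).1⟩ m
  have hle : ∀ m x : unitInterval, M.privateUtility (σ.afterMessage m) x ≤ U x := fun m x =>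
    M.privateUtility_le_indirectUtility _ x
  simp only [privateUtility_eq_add_mul] at hg hle
  obtain ⟨a, b, hab, hga, hgb, hdom⟩ := hk.exists_interval (hle 0) fun x => hg x 0
  have hdom' := fun m : unitInterval => hdom _ _ (hle m) (fun x => hg x m) m
  simp only [← privateUtility_eq_add_mul] at hdom'
  have hmin : ∀ a b, Continuous fun s => min (supportLine U k a s) (supportLine U k b s) :=
    fun a b => (hk.continuous_supportLine continuous_const continuous_id).min
      (hk.continuous_supportLine continuous_const continuous_id)
  have hintσ : Integrable (fun s : unitInterval => M.privateUtility (σ.afterMessage s) s) M.τ :=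
    M.integrable_privateUtility_afterMessage σ measurable_id
  have hintL : Integrable (fun s => supportLine U k (clamp a b s) s) M.τ :=
    integrable_of_continuous (hk.continuous_supportLine (continuous_clamp a b) continuous_id)
  have hinf : ⨅ β : Reporting, M.expectedUtility β σ ≤
      ∫ s, min (supportLine U k a s) (supportLine U k b s) ∂M.τ := by
    refine M.iInf_expectedUtility_le_integral σ (hmin a b) (integrable_of_continuous (hmin a b))
      fun s ε hε => exists_lt_of_ciInf_lt ?_
    exact (le_min (hga s) (hgb s)).trans_lt (lt_add_of_pos_right _ hε)
  have htruth := integral_mono hintσ hintL fun m => (hdom' m).1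
  have hupper : M.worstCase σ ≤ intervalValue M.α M.τ U k a b := by
    unfold worstCase intervalValue
    rw [expectedUtility_truthful]
    exact add_le_add (mul_le_mul_of_nonneg_left htruth hα0.le)
      (mul_le_mul_of_nonneg_left hinf h1α.le)
  have hlower : ∀ a' b' : unitInterval, 0 < a' → a' ≤ b' → b' < 1 →
      intervalValue M.α M.τ U k a' b' ≤ M.worstCase σ := fun a' b' h1 h2 h3 =>
    (intervalValue_le_worstCase htan h1 h2 h3 hk (σ := σ₀.relabel _ (continuous_clamp a' b').measurable)
      fun m => hσ₀ _).trans (hσ _)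
  obtain ⟨p, hp, hp0, hp1⟩ := M.exists_prior
  -- Otherwise an attainable interior interval would be worth strictly more than the upper bound on
  -- the optimal payoff.
  have hint : ¬ (a = 0 ∨ b = 1) := fun hend => by
    obtain ⟨a', b', h1, h2, h3, h4⟩ :=
      hk.exists_interior_intervalValue_lt hα0.le hα1 hab hp hp0 hp1 hend
    exact absurd (hupper.trans_lt h4) (hlower a' b' h1 h2 h3).not_gt
  have ha : 0 < a := unitInterval.pos_iff_ne_zero.2 fun e => hint (.inl e)
  have hb : b < 1 := unitInterval.lt_one_iff_ne_one.2 fun e => hint (.inr e)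
  have hval : intervalValue M.α M.τ U k a b ≤ M.worstCase σ := hlower a b ha hab hb
  -- Both payoff components are bounded by those of the interval while the totals satisfy the
  -- reverse inequality; as `α > 0`, the truthful components agree.
  have htruth' : ∫ s : unitInterval, M.privateUtility (σ.afterMessage s) s ∂M.τ =
      ∫ s, supportLine U k (clamp a b s) s ∂M.τ := by
    refine htruth.antisymm (le_of_mul_le_mul_left ?_ hα0)
    have := mul_le_mul_of_nonneg_left hinf h1α.le
    unfold worstCase intervalValue at hval
    rw [expectedUtility_truthful] at hval
    linarith
  have hrule : ∀ᵐ m ∂M.τ, M.IsBayesOptimal (σ.afterMessage m) (clamp a b m) := by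
    filter_upwards [(integral_eq_iff_of_ae_le hintσ hintL (.of_forall fun m => (hdom' m).1)).1
      htruth'] with m hm
    exact (M.isBayesOptimal_iff _ _).2 ((hdom' m).2 hm)
  obtain ⟨N, σ', hN, hN0, hσ', hag⟩ := M.exists_modification hσ₀ hrule
  have hmem : ∀ V : Set unitInterval, IsOpen V → V.Nonempty → ∃ m ∈ V, m ∉ N := fun V hV hne => by
    by_contra! hsub
    exact (hV.measure_pos M.τ hne).ne' (measure_mono_null hsub hN0)
  obtain ⟨m₁, hm₁, hm₁N⟩ := hmem (Iio a) isOpen_Iio ⟨0, ha⟩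
  obtain ⟨m₂, hm₂, hm₂N⟩ := hmem (Ioi b) isOpen_Ioi ⟨1, hb⟩
  classical
  -- The adversary induces the lower of the extreme tangents by a message on either side of the
  -- interval. Both messages avoid `N`, so one report is adversarial against `σ` and `σ'` alike.
  let r : unitInterval → unitInterval := fun s =>
    if supportLine U k a s ≤ supportLine U k b s then m₁ else m₂
  have hr : Measurable r := Measurable.ite (isClosed_le
    (hk.continuous_supportLine continuous_const continuous_id)
    (hk.continuous_supportLine continuous_const continuous_id)).measurableSet
    measurable_const measurable_const
  let β : Reporting := ⟨Kernel.deterministic r hr, inferInstance⟩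
  have hβN : ∀ᵐ s ∂M.τ, β.1 s N = 0 := .of_forall fun s => by
    have : r s ∉ N := by
      simp only [r]
      split_ifs <;> assumption
    simp [β, Kernel.deterministic_apply, Measure.dirac_apply' _ hN, this]
  have hline := fun m => privateUtility_eq_supportLine_clamp htan ha hab hb (hσ' m)
  have hβ' : M.expectedUtility β σ' =
      ∫ s, min (supportLine U k a s) (supportLine U k b s) ∂M.τ := by
    rw [expectedUtility_deterministic]
    refine integral_congr_ae (.of_forall fun s => ?_)
    simp only [hline, r]
    split_ifs with hs
    · rw [clamp_of_lt hm₁, min_eq_left hs]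
    · rw [clamp_of_gt hab hm₂, min_eq_right (not_le.1 hs).le]
  have hlawβ := M.outcomeLaw_congr hN hβN hag
  have hlawt := M.outcomeLaw_congr hN (M.truthful_ae_eq_zero hN hN0) hag
  have hβ : M.expectedUtility β σ = M.expectedUtility β σ' := by
    unfold expectedUtility
    rw [hlawβ]
  have ht : M.expectedUtility truthful σ = M.expectedUtility truthful σ' := by
    unfold expectedUtility
    rw [hlawt]
  have hpay : M.α * M.expectedUtility truthful σ + (1 - M.α) * M.expectedUtility β σ =
      intervalValue M.α M.τ U k a b := by
    rw [hβ, hβ', expectedUtility_truthful, htruth', intervalValue]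
  refine ⟨a, b, ha, hab, hb, hrule, σ', hσ', β, β, M.isAdversarial_of_le (hpay.le.trans hval),
    M.isAdversarial_of_le ?_, ?_⟩
  · rw [← hβ, ← ht, hpay]
    exact intervalValue_le_worstCase htan ha hab hb hk hσ'
  · rw [totalLaw, totalLaw, hlawβ, hlawt]

end Model
end TrustRegion

/-! ### Assembly -/

theorem mainTheorem10 {A Θ : Type*}
    [MetricSpace A] [CompactSpace A] [MeasurableSpace A] [BorelSpace A]
    [MetricSpace Θ] [CompactSpace Θ] [MeasurableSpace Θ] [BorelSpace Θ]
    (M : TrustRegion.Model A Θ)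
    (hconv : StrictConvexOn ℝ (Set.Icc 0 1) M.indirectUtility)
    (hdiff : DifferentiableOn ℝ M.indirectUtility (Set.Ioo 0 1))
    (hdiff2 : DifferentiableOn ℝ (deriv M.indirectUtility) (Set.Ioo 0 1))
    (σ : TrustRegion.Strategy A Θ) (hσ : M.IsOptimal σ) :
    ∃ lo hi : unitInterval, lo ≤ hi ∧
      -- almost every message is answered by a Bayes-optimal private strategy for the belief
      -- that the trust interval assigns to it
      (∀ᵐ m ∂M.τ, TrustRegion.TrustIntervalRule (fun ρ μ => M.IsBayesOptimal ρ μ) σ lo hi m) ∧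
      -- every choice of Bayes-optimal private strategies yields the same payoffs in each state
      (∀ σ₀ : unitInterval → TrustRegion.PrivateStrategy A Θ,
        (∀ μ ∈ Set.Ioo (0 : unitInterval) 1, M.IsBayesOptimal (σ₀ μ) μ) →
        ∀ᵐ m ∂M.τ, TrustRegion.TrustIntervalRule
          (fun ρ μ => ∀ ω, M.stateUtility ρ ω = M.stateUtility (σ₀ μ) ω) σ lo hi m) ∧
      -- if Bayes-optimal private strategies are unique, up to null sets of types, the strategy
      -- coincides with them
      (∀ σ₀ : unitInterval → TrustRegion.PrivateStrategy A Θ,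
        (∀ μ ∈ Set.Ioo (0 : unitInterval) 1, M.IsBayesOptimal (σ₀ μ) μ ∧
          ∀ ρ : TrustRegion.PrivateStrategy A Θ, M.IsBayesOptimal ρ μ →
            ∀ ω, ∀ᵐ θ ∂M.f ω, ρ.1 θ = (σ₀ μ).1 θ) →
        ∀ᵐ m ∂M.τ, TrustRegion.TrustIntervalRule
          (fun ρ μ => ∀ ω, ∀ᵐ θ ∂M.f ω, ρ.1 θ = (σ₀ μ).1 θ) σ lo hi m) ∧
      -- the strategy is equivalent to a trust region strategy with trust region `[lo, hi]`, which
      -- follows the rule after every single message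
      ∃ σ' : TrustRegion.Strategy A Θ,
        M.IsTrustRegionStrategy σ' (Set.Icc lo hi) ∧
        (∀ m, TrustRegion.TrustIntervalRule (fun ρ μ => M.IsBayesOptimal ρ μ) σ' lo hi m) ∧
        M.Equivalent σ σ' := by
  have hf := M.f_prob 0
  obtain ⟨θ⟩ : Nonempty Θ := MeasureTheory.nonempty_of_isProbabilityMeasure (M.f 0)
  have hσm := σ.2
  have hA : Nonempty A := MeasureTheory.nonempty_of_isProbabilityMeasure (σ.1 (0, θ))
  obtain ⟨σ₀, hσ₀⟩ := M.exists_bayesOptimal_strategy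
  obtain ⟨k, hk, htan⟩ := M.exists_supportSlopes hconv hdiff hdiff2.continuousOn
  -- Only `lo < 1` and `0 < hi` are required, since for `α = 1` the interval is all of `[0, 1]`.
  suffices h : ∃ lo hi : unitInterval, lo ≤ hi ∧ lo < 1 ∧ 0 < hi ∧
      (∀ᵐ m ∂M.τ, M.IsBayesOptimal (σ.afterMessage m) (TrustRegion.clamp lo hi m)) ∧
      ∃ σ' : TrustRegion.Strategy A Θ, M.IsTrustRegionStrategy σ' (Set.Icc lo hi) ∧
        (∀ m, M.IsBayesOptimal (σ'.afterMessage m) (TrustRegion.clamp lo hi m)) ∧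
        M.Equivalent σ σ' by
    obtain ⟨lo, hi, hle, hlo, hhi, hae, σ', htr, hrule, heq⟩ := h
    have hae' : ∀ᵐ m ∂M.τ,
        TrustRegion.TrustIntervalRule (fun ρ μ => M.IsBayesOptimal ρ μ) σ lo hi m :=
      hae.mono fun m hm => TrustRegion.trustIntervalRule_of_clamp hle hm
    refine ⟨lo, hi, hle, hae', fun σ₁ hσ₁ => ?_, fun σ₁ hσ₁ => ?_, σ', htr,
      fun m => TrustRegion.trustIntervalRule_of_clamp hle (hrule m), heq⟩
    · exact M.ae_trustIntervalRule_mono hlo hhi hae' fun μ hμ ρ hρ ω =>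
        hρ.stateUtility_eq M hμ (hdiff.differentiableAt (isOpen_Ioo.mem_nhds hμ)) (hσ₁ μ hμ) ω
    · exact M.ae_trustIntervalRule_mono hlo hhi hae' fun μ hμ ρ hρ => (hσ₁ μ hμ).2 ρ hρ
  rcases M.α_nonneg.eq_or_lt with hα0 | hα0
  · obtain ⟨p, hp, hp0, hp1⟩ := M.exists_prior
    obtain ⟨hrule, heq⟩ := M.isBayesOptimal_prior_of_adversarial hσ₀ hσ hα0.symm hp
    have hclamp : ∀ m, M.IsBayesOptimal (σ.afterMessage m) (TrustRegion.clamp p p m) := fun m => by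
      have hm := TrustRegion.clamp_mem (le_refl p) m
      rw [le_antisymm hm.2 hm.1]
      exact hrule m
    exact ⟨p, p, le_rfl, hp1, hp0, .of_forall hclamp, σ,
      TrustRegion.Model.isTrustRegionStrategy htan hp0 le_rfl hp1 hk hclamp, hclamp, heq⟩
  rcases M.α_le_one.eq_or_lt with hα1 | hα1
  · obtain ⟨hae, σ', htr, hrule, heq⟩ := M.exists_trustInterval_of_aligned hσ₀ hσ hα1
    exact ⟨0, 1, zero_le_one, zero_lt_one, zero_lt_one, hae, σ', htr, hrule, heq⟩
  · obtain ⟨lo, hi, hlo, hle, hhi, hae, σ', hrule, heq⟩ :=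
      M.exists_trustInterval_of_mixed hσ₀ hσ hα0 hα1 hk htan
    exact ⟨lo, hi, hle, hle.trans_lt hhi, hlo.trans_le hle, hae, σ',
      TrustRegion.Model.isTrustRegionStrategy htan hlo hle hhi hk hrule, hrule, heq⟩
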